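/- **Model.** A file is cut into chunks and $k\ge 2$ distinct chunks of a perfect fountain code (a limitless supply of chunks, any $k$ of which decode the file) are needed to decode it. Time is slotted; a slot is the time needed to transfer one chunk. In each slot: (i) every peer present selects, uniformly at random and independently of the others, one of the other peers present, and, if that peer held at the beginning of the slot at least one chunk that the selecting peer lacks, it downloads one of these chunks, chosen uniformly at random (a peer that is alone does nothing); (ii) new peers arrive, of which some receive one newly generated chunk each from the server while the others join with no chunk; (iii) every peer that holds $k$ chunks leaves. The pairs (number of new peers served, number of new peers not served) are i.i.d. from slot to slot and bounded; the mean number of arrivals per slot is $\lambda>0$, and the mean number of served new peers per slot is $\min(1,\lambda)$ (the server has rate $1$; for $\lambda>1$ the arrivals split into a served stream of rate $1$ and an unserved stream of rate $\lambda-1$, for instance by independent coin tosses with probability $1/\lambda$). The system is *stable* if the Markov chain of chunk profiles (the collections of the chunk sets held by the peers, up to renaming the chunks) is positive recurrent, in the sense that some profile is reached (again) in finite mean time from every initial profile in which every peer holds fewer than $k$ chunks. For a file of size $F>0$ cut into $k$ chunks and bandwidth $C>0$, a slot lasts $F/(kC)$ units of time, so that a peer arrival rate $r$ per unit of time means $\lambda=rF/(kC)$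 arrivals per slot. The *stability region* $R_k$ is the set of the rates $r>0$ for which the system is stable whatever the law of the arrivals (as above) with mean $\lambda=rF/(kC)$ per slot, and the *capacity* is $\sup R_k$. **Theorem.** Let $F,C>0$. 1. For every integer $k\ge 2$: every rate $r$ with $0<r<k^2C/F$ belongs to $R_k$; for every rate $r>k^2C/F$ the system is unstable under every law of the arrivals with mean $rF/(kC)$ per slot; hence $\sup R_k=k^2C/F$. 2. Increasing the number of chunks of a given file by a factor $\delta$ increases the stability region by a factor $\delta^2$: if $k,k'\ge 2$ are integers with $k'=\delta k$, then $\sup R_{k'}=\delta^2\sup R_k$, and $\operatorname{int}R_{k'}=\delta^2\cdot\operatorname{int}R_k$. -/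

import Mathlib

namespace FountainP2P

noncomputable section

/-- State of the system at the beginning of a slot. Chunks produced by the (perfect, limitless)
fountain code are numbered in the order in which the server generates them: `next` is the number of
the next chunk that the server will generate. `peers` lists, for every peer present, the set of
chunks that it holds (the order of the list plays no role in the dynamics). -/
structure State where
  next : ℕ
  peers : List (Finset ℕ)

/-- The states that can occur when `k` chunks are needed to decode: a peer still present has fewer
than `k` chunks, and every chunk held by a peer has been generated already. -/
def State.Valid (k : ℕ) (x : State) : Prop :=
  ∀ P ∈ x.peers, P.card < k ∧ ∀ c ∈ P, c < x.next

/-- Two states have the same chunk profile: they agree up to the order in which the peers are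
listed and up to renaming the chunks (a name of a fountain-coded chunk carries no information). -/
def State.SameProfile (x y : State) : Prop :=
  ∃ σ : Equiv.Perm ℕ, y.peers.Perm (x.peers.map fun P => P.map σ.toEmbedding)

/-- Joint law of independent random variables with the listed laws. -/
def independent {α : Type} : List (PMF α) → PMF (List α)
  | [] => PMF.pure []
  | p :: ps => p.bind fun a => (independent ps).map fun as => a :: as

open Classical in
/-- A peer holding `P` contacts a peer holding `Q`: if `Q` has chunks missing from `P`, one of them,
chosen uniformly, is downloaded; otherwise nothing happens. -/
def contact (P Q : Finset ℕ) : PMF (Finset ℕ) :=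
  if h : (Q \ P).Nonempty then (PMF.uniformOfFinset (Q \ P) h).map fun c => insert c P
  else PMF.pure P

open Classical in
/-- Law of the chunk set of the `i`-th peer after one slot: the peer selects one of the other peers
uniformly at random and contacts it. A peer that is alone does nothing. -/
def download (l : List (Finset ℕ)) (i : Fin l.length) : PMF (Finset ℕ) :=
  if h : (Finset.univ.erase i).Nonempty then
    (PMF.uniformOfFinset (Finset.univ.erase i) h).bind fun j => contact (l.get i) (l.get j)
  else PMF.pure (l.get i)

/-- One slot of exchanges: all the peers act simultaneously and independently, on the basis of the
chunks held at the beginning of the slot. -/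
def exchange (l : List (Finset ℕ)) : PMF (List (Finset ℕ)) :=
  independent (List.ofFn fun i : Fin l.length => download l i)

/-- `g` new peers join, each with a chunk newly generated for it by the server, and `u` new
peers join empty. Then every peer with `k` chunks leaves. -/
def arrive (k n : ℕ) (l : List (Finset ℕ)) (g u : ℕ) : State where
  next := n + g
  peers := (l ++ (List.range g).map (fun j => {n + j}) ++ List.replicate u ∅).filter
    fun P => decide (P.card < k)

/-- Transition law of the system over one slot. `law` is the law of the pair
(number of new peers served by the server, number of new peers not served) in one slot; these pairs
are independent from slot to slot. -/
def step (k : ℕ) (law : PMF (ℕ × ℕ)) (x : State) : PMF State :=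
  (exchange x.peers).bind fun l => law.map fun a => arrive k x.next l a.1 a.2

open Classical in
/-- Probability that the chain started at `x` is outside `B` at all of the times `1, …, n`. -/
def avoid (k : ℕ) (law : PMF (ℕ × ℕ)) (B : Set State) : ℕ → State → ENNReal
  | 0, _ => 1
  | n + 1, x => ∑' z, step k law x z * (if z ∈ B then 0 else avoid k law B n z)

/-- Expected value of the first time `n ≥ 1` at which the chain started at `x` is in `B`, that is,
the sum over `n ≥ 0` of the probabilities that this time exceeds `n`. -/
def meanTime (k : ℕ) (law : PMF (ℕ × ℕ)) (B : Set State) (x : State) : ENNReal :=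
  ∑' n, avoid k law B n x

/-- Stability, that is, positive recurrence of the Markov chain of chunk profiles: some profile is
reached (or reached again) in finite mean time from every initial state. -/
def Stable (k : ℕ) (law : PMF (ℕ × ℕ)) : Prop :=
  ∃ x : State, x.Valid k ∧ ∀ y : State, y.Valid k →
    meanTime k law {z | x.SameProfile z} y ≠ ⊤

/-- The law of the arrivals in a slot is admissible for `lam` arrivals per slot on average: the
number of arrivals in a slot is bounded, its mean is `lam`, and the stream of the new peers that are
served by the server has rate `1` if `lam ≥ 1` (the other stream then has rate `lam - 1`), and
contains all the new peers if `lam ≤ 1`. -/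
structure IsArrivalLaw (lam : ℝ) (law : PMF (ℕ × ℕ)) : Prop where
  bounded : ∃ A : ℕ, ∀ a ∈ law.support, a.1 + a.2 ≤ A
  mean_total : ∑' a, law a * ((a.1 + a.2 : ℕ) : ENNReal) = ENNReal.ofReal lam
  mean_served : ∑' a, law a * (a.1 : ENNReal) = ENNReal.ofReal (min 1 lam)

/-- Duration of a slot: the time to transfer one chunk, of size `F / k`, at bandwidth `C`. -/
def slotLength (F C : ℝ) (k : ℕ) : ℝ := F / k / C

/-- The stability region, in real time: the arrival rates `r > 0`, in peers per unit of time, for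
which the system is stable under every admissible arrival law with `r * slotLength` arrivals per
slot on average. -/
def stabilityRegion (F C : ℝ) (k : ℕ) : Set ℝ :=
  {r | 0 < r ∧ ∀ law, IsArrivalLaw (r * slotLength F C k) law → Stable k law}

/-- The maximal arrival rate of peers per unit of time. -/
def capacity (F C : ℝ) (k : ℕ) : ℝ := sSup (stabilityRegion F C k)

end

end FountainP2P

namespace FountainP2P

noncomputable section

/-! In slot time the threshold is λ = k; since λ = k · r / (k²C/F), this is the rate k²C/F. The
obstruction is the club: a crowd of peers that all hold the same set M of k - 1 chunks. Only a peer
holding a chunk outside M (an infected peer) can complete a club member. A served newcomer brings a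
fresh chunk and needs k - 1 more; while it collects them from the club, about one club member per
slot contacts it, gets its last chunk and leaves. For λ ≥ 1, served peers arrive at rate 1, so about
k - 1 members leave per slot, while λ - 1 unserved newcomers per slot end up in the club. The club
grows if λ - 1 > k - 1 and shrinks if λ - 1 < k - 1.

Instability (`not_stable`): `clubPotential` counts the peers inside M, minus slightly more than the
departures that the infected peers can still cause, minus a small multiple of the squared need of
the peers that have not settled. While it is large, it does not decrease on average
(`clubPotential_le_expect`). Since the population grows by at most A per slot, stopping on a return
to the target profile bounds the probability of no return by time n below by d / (a + A n) with d >
0. The mean time is therefore infinite (`meanTime_eq_top`).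

Stability (`stable`): the number of chunks still needed in total decreases on average over a fixed
number T of slots, from every state with many peers (`exists_drift`). Either useful downloads
already outweigh the arrivals in the first slot, or all but boundedly many peers hold one common set
M (`exists_club`). If M has k - 1 elements, the count above applies
(`expect_iter_totalNeed_le_of_saturated`). If M is smaller, served newcomers stay in the system as
long as they meet only the club, and they accumulate until they feed it faster than arrivals add
need (`expect_iter_totalNeed_le_of_unsaturated`). Together with a profile that can be reached from
everywhere (`exists_reach`), Foster's criterion gives finite mean times
(`meanTime_ne_top_of_drift_of_reach`). -/

/-- Expected value of a real function. -/
def expect {α : Type} (p : PMF α) (f : α → ℝ) : ℝ := ∑' a, (p a).toReal * f a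

/-! ### Expectations under finitely supported laws -/

section Expect
variable {α β : Type} {p : PMF α} {f g : α → ℝ}

lemma expect_eq_sum {s : Finset α} (hs : p.support ⊆ s) (f : α → ℝ) :
    expect p f = ∑ a ∈ s, (p a).toReal * f a := by
  refine tsum_eq_sum fun a ha => ?_
  have : p a = 0 := by
    by_contra h
    exact ha (hs ((PMF.mem_support_iff p a).2 h))
  simp [this]

lemma sum_toReal_eq_one {s : Finset α} (hs : p.support ⊆ s) : ∑ a ∈ s, (p a).toReal = 1 := by
  have h1 : ∑ a ∈ s, p a = 1 := by
    rw [← PMF.tsum_coe p]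
    refine (tsum_eq_sum fun a ha => ?_).symm
    by_contra h
    exact ha (hs ((PMF.mem_support_iff p a).2 h))
  rw [← ENNReal.toReal_sum fun a _ => p.apply_ne_top a, h1, ENNReal.toReal_one]

lemma expect_congr (h : ∀ a ∈ p.support, f a = g a) : expect p f = expect p g := by
  refine tsum_congr fun a => ?_
  by_cases ha : a ∈ p.support
  · rw [h a ha]
  · rw [PMF.mem_support_iff, not_not] at ha
    simp [ha]

lemma expect_pure (a : α) (f : α → ℝ) : expect (PMF.pure a) f = f a := by
  rw [expect_eq_sum (s := {a}) (by simp)]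
  simp

lemma expect_const (hp : p.support.Finite) (c : ℝ) : expect p (fun _ => c) = c := by
  rw [expect_eq_sum (s := hp.toFinset) (by simp), ← Finset.sum_mul, sum_toReal_eq_one (by simp),
    one_mul]

lemma expect_add (hp : p.support.Finite) (f g : α → ℝ) :
    expect p (fun a => f a + g a) = expect p f + expect p g := by
  simp_rw [expect_eq_sum (p := p) (s := hp.toFinset) (by simp), mul_add, Finset.sum_add_distrib]

lemma expect_sub (hp : p.support.Finite) (f g : α → ℝ) :
    expect p (fun a => f a - g a) = expect p f - expect p g := by
  simp_rw [expect_eq_sum (p := p) (s := hp.toFinset) (by simp), mul_sub, Finset.sum_sub_distrib]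

lemma expect_const_mul (c : ℝ) (f : α → ℝ) : expect p (fun a => c * f a) = c * expect p f := by
  simp_rw [expect, ← tsum_mul_left]
  exact tsum_congr fun a => by ring

lemma expect_mul_const (c : ℝ) (f : α → ℝ) : expect p (fun a => f a * c) = expect p f * c := by
  simp_rw [mul_comm _ c, expect_const_mul]

lemma expect_div_const (c : ℝ) (f : α → ℝ) : expect p (fun a => f a / c) = expect p f / c := by
  simp_rw [div_eq_mul_inv, expect_mul_const]

lemma expect_sum {ι : Type} (hp : p.support.Finite) (s : Finset ι) (f : ι → α → ℝ) :
    expect p (fun a => ∑ i ∈ s, f i a) = ∑ i ∈ s, expect p (f i) := by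
  classical
  induction s using Finset.induction_on with
  | empty => simpa using expect_const hp 0
  | insert i s hi ih => simp_rw [Finset.sum_insert hi, expect_add hp, ih]

lemma expect_mono (hp : p.support.Finite) (h : ∀ a ∈ p.support, f a ≤ g a) :
    expect p f ≤ expect p g := by
  rw [expect_eq_sum (s := hp.toFinset) (by simp), expect_eq_sum (s := hp.toFinset) (by simp)]
  refine Finset.sum_le_sum fun a ha => ?_
  exact mul_le_mul_of_nonneg_left (h a (by simpa using ha)) ENNReal.toReal_nonneg

lemma expect_le_of_le (hp : p.support.Finite) {c : ℝ} (h : ∀ a ∈ p.support, f a ≤ c) :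
    expect p f ≤ c := (expect_mono hp h).trans_eq (expect_const hp c)

lemma le_expect_of_le (hp : p.support.Finite) {c : ℝ} (h : ∀ a ∈ p.support, c ≤ f a) :
    c ≤ expect p f := (expect_const hp c).symm.trans_le (expect_mono hp h)

lemma finite_support_bind {q : α → PMF β} (hp : p.support.Finite)
    (hq : ∀ a ∈ p.support, (q a).support.Finite) : (p.bind q).support.Finite := by
  rw [PMF.support_bind]
  exact hp.biUnion hq

lemma finite_support_map {q : α → β} (hp : p.support.Finite) : (p.map q).support.Finite := by
  rw [PMF.support_map]
  exact hp.image q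

lemma expect_bind {q : α → PMF β} (hp : p.support.Finite)
    (hq : ∀ a ∈ p.support, (q a).support.Finite) (f : β → ℝ) :
    expect (p.bind q) f = expect p (fun a => expect (q a) f) := by
  have hb := finite_support_bind hp hq
  rw [expect_eq_sum (s := hb.toFinset) (by simp), expect_eq_sum (s := hp.toFinset) (by simp)]
  have h1 : ∀ b, ((p.bind q) b).toReal = ∑ a ∈ hp.toFinset, (p a).toReal * (q a b).toReal := by
    intro b
    rw [PMF.bind_apply, tsum_eq_sum (s := hp.toFinset), ENNReal.toReal_sum]
    · simp
    · intro a _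
      exact ENNReal.mul_ne_top (p.apply_ne_top a) ((q a).apply_ne_top b)
    · intro a ha
      have : p a = 0 := by simpa [PMF.mem_support_iff] using ha
      simp [this]
  simp_rw [h1, Finset.sum_mul]
  rw [Finset.sum_comm]
  refine Finset.sum_congr rfl fun a ha => ?_
  have ha' : a ∈ p.support := by simpa using ha
  rw [expect_eq_sum (p := q a) (s := hb.toFinset), Finset.mul_sum]
  · exact Finset.sum_congr rfl fun b _ => by ring
  · intro b hb'
    simp only [Set.Finite.coe_toFinset, PMF.support_bind, Set.mem_iUnion]
    exact ⟨a, ha', hb'⟩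

lemma expect_map (hp : p.support.Finite) (q : α → β) (f : β → ℝ) :
    expect (p.map q) f = expect p (fun a => f (q a)) := by
  rw [PMF.map, expect_bind hp]
  · simp_rw [Function.comp, expect_pure]
  · intro a _
    simp [PMF.support_pure]

lemma expect_uniformOfFinset {s : Finset α} (hs : s.Nonempty) (f : α → ℝ) :
    expect (PMF.uniformOfFinset s hs) f = (∑ a ∈ s, f a) / s.card := by
  classical
  rw [expect_eq_sum (s := s) (by simp [PMF.support_uniformOfFinset]), Finset.sum_div]
  refine Finset.sum_congr rfl fun a ha => ?_
  rw [PMF.uniformOfFinset_apply_of_mem hs ha]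
  simp [div_eq_inv_mul]

lemma finite_support_uniformOfFinset {s : Finset α} (hs : s.Nonempty) :
    (PMF.uniformOfFinset s hs).support.Finite := by
  simp [PMF.support_uniformOfFinset]

end Expect

/-! ### Independent families -/

lemma finite_support_independent {α : Type} (ps : List (PMF α))
    (h : ∀ p ∈ ps, p.support.Finite) : (independent ps).support.Finite := by
  induction ps with
  | nil => simp [independent, PMF.support_pure]
  | cons p ps ih =>
    rw [independent]
    refine finite_support_bind (h p (by simp)) fun a _ => finite_support_map (ih fun q hq => ?_)
    exact h q (by simp [hq])

lemma mem_support_independent {α : Type} (ps : List (PMF α)) (as : List α) :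
    as ∈ (independent ps).support ↔ List.Forall₂ (fun p a => a ∈ p.support) ps as := by
  induction ps generalizing as with
  | nil => simp [independent, PMF.support_pure]
  | cons p ps ih =>
    simp only [independent, PMF.support_bind, PMF.support_map, Set.mem_iUnion, Set.mem_image, ih,
      List.forall₂_cons_left_iff]
    constructor
    · rintro ⟨a, ha, l, hl, rfl⟩
      exact ⟨a, l, ha, hl, rfl⟩
    · rintro ⟨a, l, ha, hl, rfl⟩
      exact ⟨a, ha, l, hl, rfl⟩

/-- The joint mass at a point is at least the product of the marginal masses; this makes a
prescribed scenario of one slot uniformly likely. -/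
lemma pow_le_independent_apply {α : Type} {b : ENNReal} {ps : List (PMF α)} {as : List α}
    (h : List.Forall₂ (fun p a => b ≤ p a) ps as) : b ^ ps.length ≤ independent ps as := by
  classical
  induction h with
  | nil => simp [independent]
  | @cons p a ps as hpa _ ih =>
    rw [independent, PMF.bind_apply, List.length_cons, pow_succ']
    refine le_trans ?_ (ENNReal.le_tsum a)
    gcongr
    rw [PMF.map_apply]
    refine ih.trans (le_trans ?_ (ENNReal.le_tsum as))
    simp

/-- The marginal of an independent family. -/
lemma expect_independent {α : Type} {ps : List (PMF α)} (h : ∀ p ∈ ps, p.support.Finite)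
    (f : α → ℝ) (i : ℕ) (hi : i < ps.length) :
    expect (independent ps) (fun as => (as[i]?).elim 0 f) = expect ps[i] f := by
  induction ps generalizing i with
  | nil => simp at hi
  | cons p ps ih =>
    have hps : ∀ q ∈ ps, q.support.Finite := fun q hq => h q (by simp [hq])
    have hfs := finite_support_independent ps hps
    rw [independent, expect_bind (h p (by simp)) fun a _ => finite_support_map hfs]
    simp_rw [expect_map hfs]
    cases i with
    | zero => simp [expect_const hfs]
    | succ i =>
      simp only [List.getElem?_cons_succ, List.getElem_cons_succ]
      rw [expect_const (h p (by simp)), ih hps i (by simpa using hi)]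

/-! ### Sums over the peers -/

/-- The sum of `f` over the peers of a list. -/
def total (f : Finset ℕ → ℝ) (l : List (Finset ℕ)) : ℝ := (l.map f).sum

section Total
variable (f g : Finset ℕ → ℝ) (l l' : List (Finset ℕ))

@[simp] lemma total_nil : total f [] = 0 := rfl

@[simp] lemma total_cons (P : Finset ℕ) : total f (P :: l) = f P + total f l := by
  simp [total]

@[simp] lemma total_append : total f (l ++ l') = total f l + total f l' := by
  simp [total]

lemma total_add : total (fun P => f P + g P) l = total f l + total g l := by
  simp [total, List.sum_map_add]

lemma total_neg : total (fun P => -f P) l = -total f l := by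
  induction l with
  | nil => simp
  | cons P l ih => simp [ih]; ring

lemma total_sub : total (fun P => f P - g P) l = total f l - total g l := by
  simp_rw [sub_eq_add_neg, total_add, total_neg]

lemma total_const_mul (c : ℝ) : total (fun P => c * f P) l = c * total f l := by
  simp [total, List.sum_map_mul_left]

lemma total_mul_const (c : ℝ) : total (fun P => f P * c) l = total f l * c := by
  simp [total, List.sum_map_mul_right]

lemma total_const (c : ℝ) : total (fun _ => c) l = l.length * c := by
  simp [total]

lemma total_eq_sum : total f l = ∑ i : Fin l.length, f (l.get i) := by
  rw [total, ← List.sum_ofFn]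
  congr 1
  conv_lhs => rw [← List.ofFn_get l, List.map_ofFn]
  rfl

variable {f g l}

lemma total_mono (h : ∀ P ∈ l, f P ≤ g P) : total f l ≤ total g l := List.sum_le_sum h

lemma total_congr (h : ∀ P ∈ l, f P = g P) : total f l = total g l :=
  le_antisymm (total_mono fun P hP => (h P hP).le) (total_mono fun P hP => (h P hP).ge)

lemma total_nonneg (h : ∀ P ∈ l, 0 ≤ f P) : 0 ≤ total f l :=
  List.sum_nonneg (by simpa using h)

lemma total_filter (p : Finset ℕ → Prop) [DecidablePred p] (h : ∀ P, ¬ p P → f P = 0) :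
    total f (l.filter fun P => decide (p P)) = total f l := by
  induction l with
  | nil => simp
  | cons P l ih =>
    by_cases hP : p P
    · simp [hP, ih]
    · simp [hP, ih, h P hP]

lemma sum_erase_get (i : Fin l.length) :
    ∑ j ∈ Finset.univ.erase i, f (l.get j) = total f l - f (l.get i) := by
  rw [total_eq_sum, ← Finset.sum_erase_add _ _ (Finset.mem_univ i)]
  ring

end Total

/-! ### A single contact -/

section Contact
variable {P Q P' : Finset ℕ} {f : Finset ℕ → ℝ}

lemma mem_support_contact : P' ∈ (contact P Q).support ↔
    (Q ⊆ P ∧ P' = P) ∨ ∃ c ∈ Q, c ∉ P ∧ P' = insert c P := by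
  rw [contact]
  split_ifs with h
  · simp only [PMF.support_map, PMF.support_uniformOfFinset, Set.mem_image, Finset.mem_coe,
      Finset.mem_sdiff]
    obtain ⟨c, hc⟩ := h
    rw [Finset.mem_sdiff] at hc
    constructor
    · rintro ⟨d, hd, rfl⟩
      exact Or.inr ⟨d, hd.1, hd.2, rfl⟩
    · rintro (⟨h1, _⟩ | ⟨d, h1, h2, rfl⟩)
      · exact absurd (h1 hc.1) hc.2
      · exact ⟨d, ⟨h1, h2⟩, rfl⟩
  · rw [Finset.not_nonempty_iff_eq_empty, Finset.sdiff_eq_empty_iff_subset] at h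
    simp only [PMF.support_pure, Set.mem_singleton_iff, h, true_and]
    constructor
    · exact Or.inl
    · rintro (h1 | ⟨d, h1, h2, _⟩)
      · exact h1
      · exact absurd (h h1) h2

lemma finite_support_contact : (contact P Q).support.Finite := by
  rw [contact]
  split_ifs with h
  · exact finite_support_map (finite_support_uniformOfFinset h)
  · simp [PMF.support_pure]

lemma inv_le_contact_apply {k : ℕ} (hQ : Q.card ≤ k) (hk : 1 ≤ k)
    (h : P' ∈ (contact P Q).support) : (k : ENNReal)⁻¹ ≤ contact P Q P' := by
  rw [mem_support_contact] at h
  rw [contact]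
  split_ifs with hne
  · rcases h with ⟨h1, _⟩ | ⟨c, h1, h2, rfl⟩
    · obtain ⟨c, hc⟩ := hne
      rw [Finset.mem_sdiff] at hc
      exact absurd (h1 hc.1) hc.2
    · rw [PMF.map_apply]
      refine le_trans ?_ (ENNReal.le_tsum c)
      rw [if_pos rfl, PMF.uniformOfFinset_apply_of_mem hne (by simp [h1, h2])]
      gcongr
      exact (Finset.card_le_card Finset.sdiff_subset).trans hQ
  · rcases h with ⟨h1, rfl⟩ | ⟨c, h1, h2, rfl⟩
    · simp only [PMF.pure_apply, if_true]
      exact ENNReal.inv_le_one.2 (by exact_mod_cast hk)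
    · exact absurd ⟨c, by simp [h1, h2]⟩ hne

lemma expect_contact_le {b : ℝ} (h : Q ⊆ P → f P ≤ b)
    (h' : ∀ c ∈ Q, c ∉ P → f (insert c P) ≤ b) : expect (contact P Q) f ≤ b := by
  refine expect_le_of_le finite_support_contact fun P' hP' => ?_
  rcases mem_support_contact.1 hP' with ⟨h1, rfl⟩ | ⟨c, h1, h2, rfl⟩
  exacts [h h1, h' c h1 h2]

lemma le_expect_contact {b : ℝ} (h : Q ⊆ P → b ≤ f P)
    (h' : ∀ c ∈ Q, c ∉ P → b ≤ f (insert c P)) : b ≤ expect (contact P Q) f := by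
  refine le_expect_of_le finite_support_contact fun P' hP' => ?_
  rcases mem_support_contact.1 hP' with ⟨h1, rfl⟩ | ⟨c, h1, h2, rfl⟩
  exacts [h h1, h' c h1 h2]

end Contact

/-! ### The exchanges of one slot -/

section Download
variable {l l' : List (Finset ℕ)}

lemma erase_nonempty_iff (i : Fin l.length) :
    (Finset.univ.erase i).Nonempty ↔ 2 ≤ l.length := by
  rw [← Finset.card_pos, Finset.card_erase_of_mem (Finset.mem_univ i), Finset.card_univ,
    Fintype.card_fin]
  omega

lemma finite_support_download (i : Fin l.length) : (download l i).support.Finite := by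
  rw [download]
  split_ifs with h
  · exact finite_support_bind (finite_support_uniformOfFinset h) fun _ _ => finite_support_contact
  · simp [PMF.support_pure]

lemma expect_download (h : 2 ≤ l.length) (i : Fin l.length) (f : Finset ℕ → ℝ) :
    expect (download l i) f =
      (∑ j ∈ Finset.univ.erase i, expect (contact (l.get i) (l.get j)) f) / (l.length - 1) := by
  have hne := (erase_nonempty_iff i).2 h
  rw [download, dif_pos hne, expect_bind (finite_support_uniformOfFinset hne)
    fun _ _ => finite_support_contact, expect_uniformOfFinset,
    Finset.card_erase_of_mem (Finset.mem_univ i), Finset.card_univ, Fintype.card_fin,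
    Nat.cast_sub (by omega), Nat.cast_one]

lemma download_of_length_lt (h : l.length < 2) (i : Fin l.length) :
    download l i = PMF.pure (l.get i) := by
  rw [download, dif_neg]
  rw [erase_nonempty_iff]
  omega

lemma mem_support_download (i : Fin l.length) (P' : Finset ℕ) :
    P' ∈ (download l i).support ↔ (l.length < 2 ∧ P' = l.get i) ∨
      ∃ j, j ≠ i ∧ P' ∈ (contact (l.get i) (l.get j)).support := by
  rcases lt_or_ge l.length 2 with h | h
  · rw [download_of_length_lt h]
    simp only [PMF.support_pure, Set.mem_singleton_iff, h, true_and]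
    constructor
    · exact Or.inl
    · rintro (h1 | ⟨j, hj, _⟩)
      · exact h1
      · exact absurd (Fin.ext (by omega)) hj
  · have hne := (erase_nonempty_iff i).2 h
    rw [download, dif_pos hne]
    simp [PMF.support_bind, PMF.support_uniformOfFinset, h.not_gt]

/-- A possible outcome requires at most one choice among at most N peers and one among at most k
chunks. -/
lemma le_download_apply {k N : ℕ} (hk : 1 ≤ k) (hN : l.length ≤ N)
    (hl : ∀ P ∈ l, P.card ≤ k) (i : Fin l.length) {P' : Finset ℕ}
    (h : P' ∈ (download l i).support) :
    (N : ENNReal)⁻¹ * (k : ENNReal)⁻¹ ≤ download l i P' := by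
  have hi := i.2
  rcases (mem_support_download i P').1 h with ⟨h1, rfl⟩ | ⟨j, hj, hc⟩
  · rw [download_of_length_lt h1]
    simp only [PMF.pure_apply, if_true]
    exact mul_le_one' (ENNReal.inv_le_one.2 (by exact_mod_cast (by omega : 1 ≤ N)))
      (ENNReal.inv_le_one.2 (by exact_mod_cast hk))
  · have hne : (Finset.univ.erase i).Nonempty := ⟨j, by simp [hj]⟩
    rw [download, dif_pos hne, PMF.bind_apply]
    refine le_trans ?_ (ENNReal.le_tsum j)
    rw [PMF.uniformOfFinset_apply_of_mem hne (by simp [hj])]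
    gcongr
    · refine (Finset.card_le_univ _).trans ?_
      simpa using hN
    · exact inv_le_contact_apply (hl _ (List.get_mem l j)) hk hc

/-- A bound on the expected value of `f` after a download, from bounds for all the contacts. -/
lemma expect_download_le {f φ : Finset ℕ → ℝ} (h : 2 ≤ l.length) (i : Fin l.length)
    (hφ : ∀ Q ∈ l, expect (contact (l.get i) Q) f ≤ φ Q) :
    expect (download l i) f ≤ (total φ l - φ (l.get i)) / (l.length - 1) := by
  have h2 : (2 : ℝ) ≤ l.length := by exact_mod_cast h
  rw [expect_download h, ← sum_erase_get]
  gcongr with j _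
  · linarith
  · exact hφ _ (List.get_mem l j)

lemma le_expect_download {f φ : Finset ℕ → ℝ} (h : 2 ≤ l.length) (i : Fin l.length)
    (hφ : ∀ Q ∈ l, φ Q ≤ expect (contact (l.get i) Q) f) :
    (total φ l - φ (l.get i)) / (l.length - 1) ≤ expect (download l i) f := by
  have h2 : (2 : ℝ) ≤ l.length := by exact_mod_cast h
  rw [expect_download h, ← sum_erase_get]
  gcongr with j _
  · linarith
  · exact hφ _ (List.get_mem l j)

lemma finite_support_exchange : (exchange l).support.Finite := by
  refine finite_support_independent _ fun p hp => ?_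
  obtain ⟨i, rfl⟩ := (List.mem_ofFn' _ _).1 hp
  exact finite_support_download i

lemma mem_support_exchange : l' ∈ (exchange l).support ↔
    ∃ h : l'.length = l.length, ∀ i : Fin l.length,
      l'.get (Fin.cast h.symm i) ∈ (download l i).support := by
  rw [exchange, mem_support_independent, List.forall₂_iff_get]
  constructor
  · rintro ⟨h1, h2⟩
    have h1' : l'.length = l.length := by simpa using h1.symm
    refine ⟨h1', fun i => ?_⟩
    simpa using h2 i.1 (by simp) (by simp [h1'])
  · rintro ⟨h1, h2⟩
    refine ⟨by simp [h1], fun i hi hi' => ?_⟩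
    simpa using h2 ⟨i, by simpa using hi⟩

lemma length_of_mem_exchange (h : l' ∈ (exchange l).support) : l'.length = l.length :=
  (mem_support_exchange.1 h).1

lemma exists_of_mem_exchange (h : l' ∈ (exchange l).support) {P' : Finset ℕ} (hP' : P' ∈ l') :
    ∃ P ∈ l, P' = P ∨ ∃ Q ∈ l, ∃ c ∈ Q, c ∉ P ∧ P' = insert c P := by
  obtain ⟨hlen, h⟩ := mem_support_exchange.1 h
  obtain ⟨i, hi, rfl⟩ := List.getElem_of_mem hP'
  refine ⟨l[i], List.getElem_mem _, ?_⟩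
  rcases (mem_support_download _ _).1 (h ⟨i, hlen.symm ▸ hi⟩) with ⟨_, h2⟩ | ⟨j, _, hc⟩
  · exact Or.inl h2
  · rcases mem_support_contact.1 hc with ⟨_, h2⟩ | ⟨c, h1, h2, h3⟩
    · exact Or.inl h2
    · exact Or.inr ⟨_, List.get_mem l j, c, h1, h2, h3⟩

lemma le_exchange_apply {k N : ℕ} (hk : 1 ≤ k) (hN : l.length ≤ N)
    (hl : ∀ P ∈ l, P.card ≤ k) (h : l' ∈ (exchange l).support) :
    ((N : ENNReal)⁻¹ * (k : ENNReal)⁻¹) ^ l.length ≤ exchange l l' := by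
  obtain ⟨hlen, h⟩ := mem_support_exchange.1 h
  have := pow_le_independent_apply (b := (N : ENNReal)⁻¹ * (k : ENNReal)⁻¹)
    (ps := List.ofFn fun i : Fin l.length => download l i) (as := l') (by
      rw [List.forall₂_iff_get]
      refine ⟨by simp [hlen], fun i hi hi' => ?_⟩
      simpa using le_download_apply hk hN hl _ (h ⟨i, by simpa using hi⟩))
  rwa [List.length_ofFn] at this

/-- The expected value of a sum over the peers after the exchanges. -/
lemma expect_exchange_sum (w : Fin l.length → Finset ℕ → ℝ) :
    expect (exchange l) (fun l' => ∑ i : Fin l.length, (l'[i.1]?).elim 0 (w i)) =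
      ∑ i, expect (download l i) (w i) := by
  rw [expect_sum finite_support_exchange]
  refine Finset.sum_congr rfl fun i _ => ?_
  rw [exchange, expect_independent _ _ i.1 (by simp)]
  · simp
  · intro p hp
    obtain ⟨i, rfl⟩ := (List.mem_ofFn' _ _).1 hp
    exact finite_support_download i

lemma total_eq_sum_getElem? {n : ℕ} (h : l'.length = n) (f : Finset ℕ → ℝ) :
    total f l' = ∑ i : Fin n, (l'[i.1]?).elim 0 f := by
  subst h
  rw [total_eq_sum]
  simp

lemma expect_exchange_total (f : Finset ℕ → ℝ) :
    expect (exchange l) (total f) = ∑ i, expect (download l i) f := by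
  rw [← expect_exchange_sum]
  exact expect_congr fun l' hl' => total_eq_sum_getElem? (length_of_mem_exchange hl') f

lemma expect_exchange_total_of_length_lt (h : l.length < 2) (f : Finset ℕ → ℝ) :
    expect (exchange l) (total f) = total f l := by
  rw [expect_exchange_total, total_eq_sum]
  exact Finset.sum_congr rfl fun i _ => by rw [download_of_length_lt h, expect_pure]

/-- A bound on the expected value of a sum over the peers after the exchanges, from bounds for all
the contacts. -/
lemma expect_exchange_total_le {f f₀ : Finset ℕ → ℝ} {φ : Finset ℕ → Finset ℕ → ℝ}
    (h : 2 ≤ l.length)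
    (hφ : ∀ P ∈ l, ∀ Q ∈ l, expect (contact P Q) f ≤ f₀ P - φ P Q)
    (hdiag : ∀ P ∈ l, φ P P ≤ 0) :
    expect (exchange l) (total f) ≤
      total f₀ l - total (fun P => total (φ P) l) l / (l.length - 1) := by
  have h2 : (2 : ℝ) ≤ l.length := by exact_mod_cast h
  have h1 : (0 : ℝ) < l.length - 1 := by linarith
  have hsum : total f₀ l - total (fun P => total (φ P) l) l / (l.length - 1) =
      total (fun P => f₀ P - total (φ P) l / (l.length - 1)) l := by
    simp_rw [total_sub, div_eq_mul_inv, total_mul_const]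
  rw [expect_exchange_total, hsum, total_eq_sum]
  refine Finset.sum_le_sum fun i _ => ?_
  have hi := List.get_mem l i
  refine (expect_download_le h i fun Q hQ => hφ _ hi Q hQ).trans ?_
  rw [total_sub, total_const, div_le_iff₀ h1, sub_mul, div_mul_cancel₀ _ h1.ne']
  -- The double sum runs over all ordered pairs, although no peer contacts itself; the surplus
  -- diagonal term has the favourable sign.
  nlinarith [hdiag _ hi]

lemma expect_exchange_total_neg (f : Finset ℕ → ℝ) :
    expect (exchange l) (total fun P => -f P) = -expect (exchange l) (total f) := by
  rw [show (total fun P => -f P) = fun l => (-1) * total f l from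
    funext fun l => by rw [total_neg]; ring, expect_const_mul]
  ring

end Download

/-! ### Moments of the arrival law -/

section Law
variable {lam : ℝ} {law : PMF (ℕ × ℕ)}

lemma finite_support_of_bounded {A : ℕ} (hA : ∀ a ∈ law.support, a.1 + a.2 ≤ A) :
    law.support.Finite := by
  refine ((Set.finite_Iic A).prod (Set.finite_Iic A)).subset fun a ha => ?_
  have := hA a ha
  simp only [Set.mem_prod, Set.mem_Iic]
  omega

lemma expect_eq_of_tsum_eq {f : ℕ × ℕ → ℕ} {c : ℝ} (hc : 0 ≤ c)
    (h : ∑' a, law a * (f a : ENNReal) = ENNReal.ofReal c) :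
    expect law (fun a => (f a : ℝ)) = c := by
  rw [← ENNReal.toReal_ofReal hc, ← h, ENNReal.tsum_toReal_eq, expect]
  · simp
  · exact fun a => ENNReal.mul_ne_top (law.apply_ne_top a) (by simp)

lemma IsArrivalLaw.expect_served (h : IsArrivalLaw lam law) (hlam : 0 ≤ lam) :
    expect law (fun a => (a.1 : ℝ)) = min 1 lam :=
  expect_eq_of_tsum_eq (le_min zero_le_one hlam) h.mean_served

lemma IsArrivalLaw.expect_unserved (h : IsArrivalLaw lam law) (hlam : 0 ≤ lam) :
    expect law (fun a => (a.2 : ℝ)) = lam - min 1 lam := by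
  obtain ⟨A, hA⟩ := h.bounded
  have h1 := expect_eq_of_tsum_eq hlam h.mean_total
  simp_rw [Nat.cast_add] at h1
  rw [expect_add (finite_support_of_bounded hA), h.expect_served hlam] at h1
  linarith

lemma IsArrivalLaw.exists_served (h : IsArrivalLaw lam law) (hlam : 0 < lam) :
    ∃ a ∈ law.support, 1 ≤ a.1 := by
  by_contra! hcon
  have h1 := h.expect_served hlam.le
  rw [expect_congr (g := fun _ => 0)] at h1
  · obtain ⟨A, hA⟩ := h.bounded
    rw [expect_const (finite_support_of_bounded hA)] at h1
    exact (lt_min one_pos hlam).ne h1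
  · intro a ha
    have := hcon a ha
    simp only [Nat.cast_eq_zero]
    omega

end Law

/-! ### One slot and its iterates -/

section Step
variable {k A : ℕ} {law : PMF (ℕ × ℕ)} {x z : State}

lemma mem_support_step : z ∈ (step k law x).support ↔
    ∃ l ∈ (exchange x.peers).support, ∃ a ∈ law.support, z = arrive k x.next l a.1 a.2 := by
  simp only [step, PMF.support_bind, PMF.support_map, Set.mem_iUnion, Set.mem_image, exists_prop,
    eq_comm (a := z)]

lemma finite_support_step (hlaw : law.support.Finite) : (step k law x).support.Finite :=
  finite_support_bind finite_support_exchange fun _ _ => finite_support_map hlaw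

lemma expect_step (hlaw : law.support.Finite) (F : State → ℝ) :
    expect (step k law x) F = expect (exchange x.peers) fun l =>
      expect law fun a => F (arrive k x.next l a.1 a.2) := by
  rw [step, expect_bind finite_support_exchange fun _ _ => finite_support_map hlaw]
  simp_rw [expect_map hlaw]

lemma total_map_singleton (f : Finset ℕ → ℝ) (n g : ℕ) :
    total f ((List.range g).map fun j => {n + j}) = ∑ j ∈ Finset.range g, f {n + j} := by
  induction g with
  | zero => simp
  | succ g ih => rw [List.range_succ, List.map_append, total_append, ih, Finset.sum_range_succ]; simp

lemma total_replicate (f : Finset ℕ → ℝ) (u : ℕ) (P : Finset ℕ) :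
    total f (List.replicate u P) = u * f P := by
  simp [total]

/-- Weights that vanish on sets of at least k chunks do not notice the departures; all the weights
used below are of this kind. -/
lemma total_arrive {f : Finset ℕ → ℝ} (hf : ∀ P : Finset ℕ, k ≤ P.card → f P = 0) (n : ℕ)
    (l : List (Finset ℕ)) (g u : ℕ) :
    total f (arrive k n l g u).peers =
      total f l + ∑ j ∈ Finset.range g, f {n + j} + u * f ∅ := by
  rw [arrive, total_filter (fun P => P.card < k) fun P hP => hf P (not_lt.1 hP), total_append,
    total_append, total_map_singleton, total_replicate]

/-- The expected value of a sum over the peers after one slot. -/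
lemma expect_step_total (hlaw : law.support.Finite) {f : Finset ℕ → ℝ} {c₁ c₀ : ℝ}
    (hf : ∀ P : Finset ℕ, k ≤ P.card → f P = 0) (h₁ : ∀ j, f {x.next + j} = c₁) (h₀ : f ∅ = c₀) :
    expect (step k law x) (fun z => total f z.peers) = expect (exchange x.peers) (total f) +
      (expect law (fun a => (a.1 : ℝ)) * c₁ + expect law (fun a => (a.2 : ℝ)) * c₀) := by
  rw [expect_step hlaw]
  have : ∀ l, expect law (fun a => total f (arrive k x.next l a.1 a.2).peers) = total f l +
      (expect law (fun a => (a.1 : ℝ)) * c₁ + expect law (fun a => (a.2 : ℝ)) * c₀) := by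
    intro l
    simp_rw [total_arrive hf, h₁, h₀, Finset.sum_const, Finset.card_range, nsmul_eq_mul]
    rw [expect_add hlaw, expect_add hlaw, expect_const hlaw, expect_mul_const, expect_mul_const,
      add_assoc]
  simp_rw [this]
  rw [expect_add finite_support_exchange, expect_const finite_support_exchange]

lemma length_arrive_le (n : ℕ) (l : List (Finset ℕ)) (g u : ℕ) :
    (arrive k n l g u).peers.length ≤ l.length + g + u := by
  refine (List.length_filter_le _ _).trans ?_
  simp [add_assoc]

lemma length_le_of_mem_step (hA : ∀ a ∈ law.support, a.1 + a.2 ≤ A)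
    (hz : z ∈ (step k law x).support) : z.peers.length ≤ x.peers.length + A := by
  obtain ⟨l, hl, a, ha, rfl⟩ := mem_support_step.1 hz
  have h1 := length_arrive_le (k := k) x.next l a.1 a.2
  have h2 := length_of_mem_exchange hl
  have h3 := hA a ha
  omega

lemma mem_arrive {n g u : ℕ} {l : List (Finset ℕ)} {P : Finset ℕ} :
    P ∈ (arrive k n l g u).peers ↔
      (P ∈ l ∨ (∃ j < g, P = {n + j}) ∨ (u ≠ 0 ∧ P = ∅)) ∧ P.card < k := by
  simp only [arrive, List.mem_filter, List.mem_append, List.mem_map, List.mem_range,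
    List.mem_replicate, decide_eq_true_eq, eq_comm (b := P), or_assoc, ne_eq]

lemma State.Valid.step (hx : x.Valid k) (hz : z ∈ (step k law x).support) : z.Valid k := by
  obtain ⟨l, hl, a, ha, rfl⟩ := mem_support_step.1 hz
  intro P hP
  rw [mem_arrive] at hP
  refine ⟨hP.2, fun c hc => ?_⟩
  change c < x.next + a.1
  rcases hP.1 with h | ⟨j, hj, rfl⟩ | ⟨_, rfl⟩
  · obtain ⟨P₀, hP₀, rfl | ⟨Q, hQ, d, hd, _, rfl⟩⟩ := exists_of_mem_exchange hl h
    · have := (hx _ hP₀).2 c hc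
      omega
    · rcases Finset.mem_insert.1 hc with rfl | hc
      · have := (hx _ hQ).2 _ hd
        omega
      · have := (hx _ hP₀).2 c hc
        omega
  · rw [Finset.mem_singleton] at hc
    omega
  · simp at hc

/-- Law of the state after the given number of slots. -/
def iter (k : ℕ) (law : PMF (ℕ × ℕ)) : ℕ → State → PMF State
  | 0, x => PMF.pure x
  | n + 1, x => (step k law x).bind (iter k law n)

lemma finite_support_iter (hlaw : law.support.Finite) (n : ℕ) (x : State) :
    (iter k law n x).support.Finite := by
  induction n generalizing x with
  | zero => simp [iter, PMF.support_pure]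
  | succ n ih => exact finite_support_bind (finite_support_step hlaw) fun z _ => ih z

lemma expect_iter_zero (F : State → ℝ) : expect (iter k law 0 x) F = F x := expect_pure x F

lemma expect_iter_succ (hlaw : law.support.Finite) (n : ℕ) (F : State → ℝ) :
    expect (iter k law (n + 1) x) F =
      expect (step k law x) fun z => expect (iter k law n z) F :=
  expect_bind (finite_support_step hlaw) (fun z _ => finite_support_iter hlaw n z) F

/-- A time-dependent potential that decreases on average along the slots. -/
lemma expect_iter_le (hlaw : law.support.Finite) {I : ℕ → State → Prop} {Φ : ℕ → State → ℝ}
    (hI : ∀ t x, I (t + 1) x → ∀ z ∈ (step k law x).support, I t z)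
    (hΦ : ∀ t x, I (t + 1) x → expect (step k law x) (Φ t) ≤ Φ (t + 1) x)
    (t : ℕ) (x : State) (hx : I t x) : expect (iter k law t x) (Φ 0) ≤ Φ t x := by
  induction t generalizing x with
  | zero => exact (expect_iter_zero _).le
  | succ t ih =>
    rw [expect_iter_succ hlaw]
    exact (expect_mono (finite_support_step hlaw) fun z hz => ih z (hI t x hx z hz)).trans
      (hΦ t x hx)

end Step

/-! ### Criteria for finite and for infinite mean times -/

section MeanTime
variable {k : ℕ} {law : PMF (ℕ × ℕ)} {B : Set State}

lemma avoid_le_one (n : ℕ) (x : State) : avoid k law B n x ≤ 1 := by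
  classical
  induction n generalizing x with
  | zero => simp [avoid]
  | succ n ih =>
    rw [avoid, ← PMF.tsum_coe (step k law x)]
    refine ENNReal.tsum_le_tsum fun z => mul_le_of_le_one_right' ?_
    split_ifs
    exacts [zero_le_one, ih z]

lemma avoid_ne_top (n : ℕ) (x : State) : avoid k law B n x ≠ ⊤ :=
  ((avoid_le_one n x).trans_lt ENNReal.one_lt_top).ne

open Classical in
/-- Probability to be outside `B` at all of the times `0, …, n`. -/
def avoidFrom (k : ℕ) (law : PMF (ℕ × ℕ)) (B : Set State) (n : ℕ) (x : State) : ℝ :=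
  if x ∈ B then 0 else (avoid k law B n x).toReal

lemma avoidFrom_of_mem {n : ℕ} {x : State} (h : x ∈ B) : avoidFrom k law B n x = 0 := if_pos h

lemma avoidFrom_of_notMem {n : ℕ} {x : State} (h : x ∉ B) :
    avoidFrom k law B n x = (avoid k law B n x).toReal := if_neg h

lemma avoidFrom_nonneg (n : ℕ) (x : State) : 0 ≤ avoidFrom k law B n x := by
  rw [avoidFrom]
  split_ifs
  exacts [le_rfl, ENNReal.toReal_nonneg]

lemma avoid_toReal_le_one (n : ℕ) (x : State) : (avoid k law B n x).toReal ≤ 1 :=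
  ENNReal.toReal_le_of_le_ofReal zero_le_one (by simpa using avoid_le_one n x)

lemma avoidFrom_le_one (n : ℕ) (x : State) : avoidFrom k law B n x ≤ 1 := by
  rw [avoidFrom]
  split_ifs
  exacts [zero_le_one, avoid_toReal_le_one n x]

lemma avoid_succ_toReal (n : ℕ) (x : State) :
    (avoid k law B (n + 1) x).toReal = expect (step k law x) (avoidFrom k law B n) := by
  rw [avoid, ENNReal.tsum_toReal_eq, expect]
  · refine tsum_congr fun z => ?_
    rw [ENNReal.toReal_mul, avoidFrom]
    split_ifs <;> simp
  · intro z
    refine ENNReal.mul_ne_top ((step k law x).apply_ne_top z) ?_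
    split_ifs
    exacts [ENNReal.zero_ne_top, avoid_ne_top n z]

lemma avoid_zero_toReal (x : State) : (avoid k law B 0 x).toReal = 1 := by simp [avoid]

/-- Foster's criterion. -/
lemma meanTime_ne_top_of_drift (hlaw : law.support.Finite) {I : State → Prop} {V : State → ℝ}
    (hI : ∀ x, I x → ∀ z ∈ (step k law x).support, I z) (hV : ∀ x, I x → 0 ≤ V x)
    (hdrift : ∀ x, I x → expect (step k law x) (Bᶜ.indicator V) ≤ V x - 1)
    {y : State} (hy : I y) : meanTime k law B y ≠ ⊤ := by
  -- Truncating the series at m turns Foster's argument into an induction on m, with no question of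
  -- convergence.
  have key : ∀ (m : ℕ) (x : State), I x →
      ∑ n ∈ Finset.range m, (avoid k law B n x).toReal ≤ V x := by
    intro m
    induction m with
    | zero => simpa using hV
    | succ m ih =>
      intro x hx
      rw [Finset.sum_range_succ']
      simp_rw [avoid_succ_toReal, avoid_zero_toReal]
      rw [← expect_sum (finite_support_step hlaw)]
      have := expect_mono (p := step k law x) (finite_support_step hlaw)
        (f := fun z => ∑ n ∈ Finset.range m, avoidFrom k law B n z) (g := Bᶜ.indicator V) (by
          intro z hz
          by_cases hzB : z ∈ B
          · simp [avoidFrom_of_mem hzB, hzB]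
          · simpa [avoidFrom_of_notMem hzB, hzB] using ih z (hI x hx z hz))
      linarith [hdrift x hx]
  have hle : meanTime k law B y ≤ ENNReal.ofReal (V y) := by
    refine ENNReal.tsum_le_of_sum_range_le fun m => ?_
    rw [← ENNReal.ofReal_toReal (a := ∑ n ∈ Finset.range m, avoid k law B n y),
      ENNReal.toReal_sum fun n _ => avoid_ne_top n y]
    · exact ENNReal.ofReal_le_ofReal (key m y hy)
    · exact ENNReal.sum_ne_top.2 fun n _ => avoid_ne_top n y
  exact (hle.trans_lt ENNReal.ofReal_lt_top).ne

/-- Infinite mean time from a lower bound of the tail by a harmonic sequence. -/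
lemma meanTime_eq_top {y : State} {a d : ℝ} {A : ℕ} (hd : 0 < d) (ha : 0 ≤ a)
    (h : ∀ n : ℕ, d ≤ (a + A * n) * (avoid k law B n y).toReal) : meanTime k law B y = ⊤ := by
  by_contra hne
  have hs := ENNReal.summable_toReal hne
  -- A finite mean would dominate a multiple of the harmonic series.
  have h1 : Summable fun n : ℕ => d / (a + A + 1) * (1 / ((n + 1 : ℕ) : ℝ)) := by
    refine Summable.of_nonneg_of_le (fun n => by positivity) (fun n => ?_) hs
    have hn := h n
    have h0 : 0 ≤ (avoid k law B n y).toReal := ENNReal.toReal_nonneg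
    rw [div_mul_div_comm, mul_one, div_le_iff₀ (by positivity)]
    refine hn.trans ?_
    rw [mul_comm]
    gcongr
    push_cast
    nlinarith [mul_nonneg ha (Nat.cast_nonneg n : (0 : ℝ) ≤ n), (Nat.cast_nonneg n : (0 : ℝ) ≤ n),
      (Nat.cast_nonneg A : (0 : ℝ) ≤ A)]
  rw [summable_mul_left_iff (by positivity)] at h1
  exact Real.not_summable_one_div_natCast ((summable_nat_add_iff 1).1 h1)

end MeanTime

/-! ### Instability: growth of a club -/

/-- Indicator of the peers that hold exactly the chunks in `M`. -/
def full (M P : Finset ℕ) : ℝ := if P = M then 1 else 0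

/-- Indicator of the peers that hold a chunk outside `M`. -/
def infected (M P : Finset ℕ) : ℝ := if P ⊆ M then 0 else 1

/-- Indicator of the peers that hold a proper part of `M`. -/
def young (M P : Finset ℕ) : ℝ := if P ⊂ M then 1 else 0

lemma full_nonneg (M P : Finset ℕ) : 0 ≤ full M P := by rw [full]; split_ifs <;> norm_num
lemma full_le_one (M P : Finset ℕ) : full M P ≤ 1 := by rw [full]; split_ifs <;> norm_num
lemma infected_nonneg (M P : Finset ℕ) : 0 ≤ infected M P := by
  rw [infected]; split_ifs <;> norm_num

lemma full_add_infected_add_young (M P : Finset ℕ) :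
    full M P + infected M P + young M P = 1 := by
  simp only [full, infected, young]
  by_cases h : P = M
  · subst h; simp
  · by_cases h' : P ⊆ M
    · simp [h, h', Finset.ssubset_iff_subset_ne]
    · have : ¬ P ⊂ M := fun hh => h' hh.subset
      simp [h, h', this]

lemma insert_not_subset {M P : Finset ℕ} (h : ¬ P ⊆ M) (c : ℕ) : ¬ insert c P ⊆ M :=
  fun hh => h ((Finset.subset_insert c P).trans hh)

lemma not_subset_of_card {k : ℕ} {M P : Finset ℕ} (hM : M.card = k - 1) (hP : P.card < k)
    (h : P ≠ M) : ¬ M ⊆ P := fun hh => h (Finset.eq_of_subset_of_card_le hh (by omega)).symm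

/-- Value of a peer for the size of the set of the peers that hold only chunks of `M`: an infected
peer is expected to serve one of them for each chunk that it still needs. -/
def clubValue (k : ℕ) (M : Finset ℕ) (η : ℝ) (P : Finset ℕ) : ℝ :=
  if P ⊆ M then 1 else -((1 + η) * (k - P.card : ℕ))

/-- Number of chunks that a peer needs, the last one not being counted if the peer holds only chunks
of `M`. -/
def clubNeed (k : ℕ) (M P : Finset ℕ) : ℝ :=
  if P ⊆ M then ((k - 1 - P.card : ℕ) : ℝ) else ((k - P.card : ℕ) : ℝ)

section
variable {k : ℕ} {M : Finset ℕ} {η : ℝ}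

lemma clubValue_eq_zero (hk : 1 ≤ k) (hM : M.card = k - 1) {P : Finset ℕ} (hP : k ≤ P.card) :
    clubValue k M η P = 0 := by
  have : ¬ P ⊆ M := fun h => by have := Finset.card_le_card h; omega
  simp [clubValue, this, Nat.sub_eq_zero_of_le hP]

lemma clubNeed_eq_zero {P : Finset ℕ} (hP : k ≤ P.card) : clubNeed k M P = 0 := by
  rw [clubNeed]
  split_ifs <;> simp <;> omega

lemma clubNeed_nonneg (P : Finset ℕ) : 0 ≤ clubNeed k M P := by
  rw [clubNeed]; split_ifs <;> positivity

lemma clubNeed_insert_le (P : Finset ℕ) {c : ℕ} (hc : c ∉ P) :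
    clubNeed k M (insert c P) ≤ clubNeed k M P := by
  simp only [clubNeed, Finset.card_insert_of_notMem hc]
  by_cases h : P ⊆ M
  · rw [if_pos h]
    split_ifs <;> (norm_cast; omega)
  · rw [if_neg h, if_neg (insert_not_subset h c)]
    norm_cast; omega

lemma clubNeed_le (hM : M.card = k - 1) (P : Finset ℕ) :
    clubNeed k M P ≤ k * (1 - full M P) := by
  rw [clubNeed, full]
  by_cases h : P = M
  · simp [h, hM]
  · simp only [h, if_false, sub_zero, mul_one]
    split_ifs <;> (norm_cast; omega)

lemma one_sub_full_le_clubNeed (hM : M.card = k - 1) {P : Finset ℕ} (hP : P.card < k) :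
    1 - full M P ≤ clubNeed k M P := by
  rw [clubNeed, full]
  by_cases h : P = M
  · simp [h]
  · simp only [h, if_false, sub_zero]
    split_ifs with h'
    · have := Finset.card_lt_card (h'.ssubset_of_ne h)
      norm_cast; omega
    · norm_cast; omega

/-- An infected peer that meets a club member gains a chunk, hence 1 + η in value. A club member
that meets an infected peer completes the file and gives up its value 1. A young peer that becomes
infected loses at most 1 + (1 + η) k ≤ 1 + 2k. Exchanges inside M change nothing. -/
lemma expect_contact_clubValue_le (hM : M.card = k - 1) (hη : 0 ≤ η)
    (hη1 : η ≤ 1) {P Q : Finset ℕ} (hP : P.card < k) :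
    expect (contact P Q) (fun P' => -clubValue k M η P') ≤ -clubValue k M η P -
      ((1 + η) * (infected M P * full M Q) -
        (full M P + (1 + 2 * k) * young M P) * infected M Q) := by
  have hk0 : (0 : ℝ) ≤ k := Nat.cast_nonneg k
  by_cases hPM : P ⊆ M
  · by_cases hQM : Q ⊆ M
    · have h0 : infected M P = 0 := by simp [infected, hPM]
      have h1 : infected M Q = 0 := by simp [infected, hQM]
      rw [h0, h1]
      refine expect_contact_le (fun _ => by simp) fun c hc _ => ?_
      have : insert c P ⊆ M := Finset.insert_subset (hQM hc) hPM
      simp [clubValue, hPM, this]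
    · have h0 : infected M P = 0 := by simp [infected, hPM]
      have h1 : infected M Q = 1 := by simp [infected, hQM]
      rw [h0, h1]
      refine expect_contact_le (fun h => absurd (h.trans hPM) hQM) fun c _ hcP => ?_
      have hval : clubValue k M η P = 1 := by simp [clubValue, hPM]
      rw [hval]
      by_cases hPe : P = M
      · have hf : full M P = 1 := by simp [full, hPe]
        have hy : young M P = 0 := by simp [young, hPe]
        have hn : ¬ insert c P ⊆ M := fun h => by
          have := h (Finset.mem_insert_self c P)
          rw [hPe] at hcP
          exact hcP this
        have hcard : k - (insert c P).card = 0 := by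
          rw [Finset.card_insert_of_notMem hcP, hPe]
          omega
        rw [hf, hy, clubValue, if_neg hn, hcard]
        simp
      · have hf : full M P = 0 := by simp [full, hPe]
        have hy : young M P = 1 := by simp [young, hPM.ssubset_of_ne hPe]
        rw [hf, hy, clubValue]
        split_ifs
        · linarith
        · have hle : ((k - (insert c P).card : ℕ) : ℝ) ≤ k := by norm_cast; omega
          have : (1 + η) * ((k - (insert c P).card : ℕ) : ℝ) ≤ 2 * k := by
            apply mul_le_mul <;> linarith
          linarith
  · have hf : full M P = 0 := by
      rw [full, if_neg]; rintro rfl; exact hPM subset_rfl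
    have hy : young M P = 0 := by
      rw [young, if_neg]; exact fun h => hPM h.subset
    have hi : infected M P = 1 := by simp [infected, hPM]
    have hval : ∀ c, c ∉ P → clubValue k M η (insert c P) = clubValue k M η P + (1 + η) := by
      intro c hc
      rw [clubValue, if_neg (insert_not_subset hPM c), clubValue, if_neg hPM,
        Finset.card_insert_of_notMem hc, show k - P.card = (k - (P.card + 1)) + 1 by omega]
      push_cast
      ring
    rw [hf, hy, hi]
    refine expect_contact_le (fun h => ?_) fun c _ hcP => ?_
    · have : full M Q = 0 := by
        rw [full, if_neg]
        rintro rfl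
        exact not_subset_of_card hM hP (fun h' => hPM h'.subset) h
      rw [this]
      simp
    · rw [hval c hcP]
      have := full_le_one M Q
      nlinarith

/-- A peer with fewer than k chunks that is not in the club cannot contain M, so it always gains
from a club member; and a peer inside M stays inside M when it does. -/
lemma expect_contact_clubNeed_le (hM : M.card = k - 1) {P Q : Finset ℕ} (hP : P.card < k) :
    expect (contact P Q) (clubNeed k M) ≤ clubNeed k M P - (1 - full M P) * full M Q := by
  by_cases h : P ≠ M ∧ Q = M
  · obtain ⟨h1, rfl⟩ := h
    have hf : full Q P = 0 := by simp [full, h1]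
    have hf' : full Q Q = 1 := by simp [full]
    rw [hf, hf']
    refine expect_contact_le (fun h => absurd h (not_subset_of_card hM hP h1)) fun c hc hcP => ?_
    simp only [clubNeed, Finset.card_insert_of_notMem hcP]
    by_cases h : P ⊆ Q
    · have := Finset.card_lt_card (h.ssubset_of_ne h1)
      rw [if_pos h, if_pos (Finset.insert_subset hc h),
        show k - 1 - P.card = (k - 1 - (P.card + 1)) + 1 by omega]
      push_cast
      linarith
    · rw [if_neg h, if_neg (insert_not_subset h c),
        show k - P.card = (k - (P.card + 1)) + 1 by omega]
      push_cast
      linarith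
  · have : (1 - full M P) * full M Q = 0 := by
      by_cases hP' : P = M
      · simp [full, hP']
      · simp only [ne_eq, hP', not_false_eq_true, true_and] at h
        simp [full, h]
    rw [this, sub_zero]
    exact expect_contact_le (fun _ => le_rfl) fun c _ hc => clubNeed_insert_le P hc

lemma total_full_add (l : List (Finset ℕ)) :
    total (full M) l + total (infected M) l + total (young M) l = l.length := by
  rw [← total_add, ← total_add, total_congr (g := fun _ => 1)
    fun P _ => full_add_infected_add_young M P, total_const, mul_one]

/-- With F, I, Y the numbers of full, infected and young peers, summing over ordered pairs gives a
mean gain of at least I (ηF - (1 + 2k) Y) / (n - 1): the gains and losses of size F I cancel, and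
the margin η pays for the young peers. -/
lemma le_expect_exchange_clubValue (hM : M.card = k - 1) (hη : 0 ≤ η) (hη1 : η ≤ 1)
    {l : List (Finset ℕ)} (hl : ∀ P ∈ l, P.card < k) (h2 : 2 ≤ l.length)
    (h : (1 + 2 * k) * total (young M) l ≤ η * total (full M) l) :
    total (clubValue k M η) l ≤ expect (exchange l) (total (clubValue k M η)) := by
  have h1 := expect_exchange_total_le (f := fun P => -clubValue k M η P) h2
    (fun P hP Q _ => expect_contact_clubValue_le (M := M) hM hη hη1 (hl P hP)) (by
      intro P _
      by_cases hP : P ⊆ M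
      · simp [infected, hP]
      · have : P ≠ M := fun h => hP h.subset
        have : ¬ P ⊂ M := fun h => hP h.subset
        simp [full, young, *])
  simp only [total_neg, total_sub, total_mul_const, total_const_mul, total_add] at h1
  rw [expect_exchange_total_neg] at h1
  have h2' : (2 : ℝ) ≤ l.length := by exact_mod_cast h2
  have hI : 0 ≤ total (infected M) l := total_nonneg fun P _ => infected_nonneg M P
  have h3 : 0 ≤ ((1 + η) * (total (infected M) l * total (full M) l) -
      (total (full M) l + (1 + 2 * k) * total (young M) l) * total (infected M) l) /
      (l.length - 1) := by
    refine div_nonneg ?_ (by linarith)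
    nlinarith [mul_nonneg hI (sub_nonneg.2 h)]
  linarith

lemma expect_exchange_clubNeed_le (hM : M.card = k - 1)
    {l : List (Finset ℕ)} (hl : ∀ P ∈ l, P.card < k) (h2 : 2 ≤ l.length) :
    expect (exchange l) (total (clubNeed k M)) ≤ total (clubNeed k M) l -
      (l.length - total (full M) l) * total (full M) l / (l.length - 1) := by
  have h1 := expect_exchange_total_le h2
    (fun P hP Q _ => expect_contact_clubNeed_le (M := M) (Q := Q) hM (hl P hP)) (by
      intro P _
      by_cases hP : P = M <;> simp [full, hP])
  simpa only [total_sub, total_mul_const, total_const_mul, total_const, mul_one] using h1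

lemma total_le_of_mem_exchange {f : Finset ℕ → ℝ} {l l' : List (Finset ℕ)}
    (hf : ∀ P c, c ∉ P → f (insert c P) ≤ f P) (h : l' ∈ (exchange l).support) :
    total f l' ≤ total f l := by
  obtain ⟨hlen, h⟩ := mem_support_exchange.1 h
  rw [total_eq_sum, total_eq_sum, ← Equiv.sum_comp (finCongr hlen.symm)]
  refine Finset.sum_le_sum fun i _ => ?_
  rcases (mem_support_download _ _).1 (h i) with ⟨_, h2⟩ | ⟨j, _, hc⟩
  · exact (congrArg f h2).le
  · rcases mem_support_contact.1 hc with ⟨_, h2⟩ | ⟨c, _, h2, h3⟩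
    · exact (congrArg f h2).le
    · exact (congrArg f h3).trans_le (hf _ c h2)

lemma total_nonneg' {f : Finset ℕ → ℝ} (hf : ∀ P, 0 ≤ f P) (l : List (Finset ℕ)) :
    0 ≤ total f l := total_nonneg fun P _ => hf P

lemma total_arrive_le {f : Finset ℕ → ℝ} (hf : ∀ P : Finset ℕ, k ≤ P.card → f P = 0)
    {b : ℝ} (hb : ∀ P, f P ≤ b) (hb0 : 0 ≤ b) (n : ℕ) (l : List (Finset ℕ)) {g u A : ℕ}
    (h : g + u ≤ A) : total f (arrive k n l g u).peers ≤ total f l + A * b := by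
  rw [total_arrive hf]
  have h1 : ∑ j ∈ Finset.range g, f {n + j} ≤ g * b := by
    refine (Finset.sum_le_sum fun j _ => hb _).trans ?_
    simp
  have h2 : (u : ℝ) * f ∅ ≤ u * b := by gcongr; exact hb _
  have h3 : ((g + u : ℕ) : ℝ) * b ≤ A * b := by gcongr
  push_cast at h3
  linarith

/-- Potential for the instability. -/
def clubPotential (k : ℕ) (M : Finset ℕ) (η q : ℝ) (x : State) : ℝ :=
  total (clubValue k M η) x.peers - total (clubNeed k M) x.peers ^ 2 / q

lemma clubPotential_le {q : ℝ} (hη : 0 ≤ η) (hq : 0 < q) (x : State) :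
    clubPotential k M η q x ≤ x.peers.length := by
  have h1 : total (clubValue k M η) x.peers ≤ x.peers.length := by
    rw [← mul_one (x.peers.length : ℝ), ← total_const]
    refine total_mono fun P _ => ?_
    rw [clubValue]
    split_ifs
    · exact le_rfl
    · have : (0 : ℝ) ≤ (1 + η) * (k - P.card : ℕ) := by positivity
      linarith
  have : 0 ≤ total (clubNeed k M) x.peers ^ 2 / q := by positivity
  rw [clubPotential]
  linarith

/-- Arrivals add λ - k - η(k - 1) to the linear part, and exchanges do no harm if young peers are
few. The quadratic part ensures this: with S the total of `clubNeed`, a positive potential forces S²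
≤ q n, so all but O(√n) peers are in the club. Moreover S contracts under a dominant club, so S²
grows by a bounded amount on average, and q is large enough to make this negligible against the
linear drift. -/
lemma clubPotential_le_expect {law : PMF (ℕ × ℕ)} {lam q : ℝ} {A : ℕ}
    (hk : 2 ≤ k) (hM : M.card = k - 1) (hη : 0 < η) (hη1 : η ≤ 1)
    (hA : ∀ a ∈ law.support, a.1 + a.2 ≤ A)
    (hs : expect law (fun a => (a.1 : ℝ)) = 1) (hu : expect law (fun a => (a.2 : ℝ)) = lam - 1)
    (hq : 0 < q)
    (hqA : (1 + 2 * k) * (k * A : ℝ) ^ 2 ≤ q * (lam - k - η * (k - 1)))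
    {x : State} (hx : x.Valid k) (hMx : ∀ c ∈ M, c < x.next)
    (hV : max 2 (q * ((η + 1 + 2 * k) / η) ^ 2) < clubPotential k M η q x) :
    clubPotential k M η q x ≤ expect (step k law x) (clubPotential k M η q) := by
  have hlaw := finite_support_of_bounded hA
  have hk' : (2 : ℝ) ≤ k := by exact_mod_cast hk
  obtain ⟨hV2, hVq⟩ := max_lt_iff.1 hV
  set l := x.peers with hl
  set n := (l.length : ℝ) with hn
  set S := total (clubNeed k M) l with hS
  set F := total (full M) l with hF
  set a : ℝ := k * A with ha
  have ha0 : 0 ≤ a := by positivity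
  have hVn := clubPotential_le (k := k) (M := M) hη.le hq x
  have hlk : ∀ P ∈ l, P.card < k := fun P hP => (hx P hP).1
  have h2n : 2 ≤ l.length := by
    have : (2 : ℝ) ≤ l.length := (hV2.trans_le hVn).le
    exact_mod_cast this
  have hn2 : 2 < n := hV2.trans_le hVn
  have hO0 : 0 ≤ n - F := by
    have := total_mono (l := l) fun P _ => full_le_one M P
    rw [total_const, mul_one] at this
    linarith
  have hOS : n - F ≤ S := by
    have := total_mono (l := l) fun P hP => one_sub_full_le_clubNeed hM (hlk P hP)
    rw [total_sub, total_const, mul_one] at this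
    exact this
  have hSO : S ≤ k * (n - F) := by
    have := total_mono (l := l) fun P _ => clubNeed_le hM P
    rw [total_const_mul, total_sub, total_const, mul_one] at this
    exact this
  have hS0 : 0 ≤ S := hO0.trans hOS
  have hYO : total (young M) l ≤ n - F := by
    have h1 := total_full_add (M := M) l
    have h2 := total_nonneg' (infected_nonneg M) l
    linarith
  have hSq : S ^ 2 ≤ q * n := by
    have h1 : S ^ 2 / q ≤ n := by
      have h1 : total (clubValue k M η) l ≤ n := by
        rw [hn, ← mul_one (l.length : ℝ), ← total_const]
        refine total_mono fun P _ => ?_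
        rw [clubValue]
        split_ifs
        · exact le_rfl
        · have : (0 : ℝ) ≤ (1 + η) * (k - P.card : ℕ) := by positivity
          linarith
      have : 0 < clubPotential k M η q x := by linarith
      rw [clubPotential] at this
      linarith
    rw [div_le_iff₀ hq] at h1
    linarith
  -- Since n - F ≤ S ≤ √(q n), the lower bound on n coming from the potential makes n - F a small
  -- fraction of n.
  have hθ : (η + 1 + 2 * k) * (n - F) ≤ η * n := by
    have h1 : (η + 1 + 2 * k) / η * (n - F) ≤ n := by
      refine abs_le_of_sq_le_sq' ?_ (by linarith) |>.2
      calc ((η + 1 + 2 * k) / η * (n - F)) ^ 2 = ((η + 1 + 2 * k) / η) ^ 2 * (n - F) ^ 2 := by ring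
        _ ≤ ((η + 1 + 2 * k) / η) ^ 2 * (q * n) := by
          gcongr
          exact (pow_le_pow_left₀ hO0 hOS 2).trans hSq
        _ = q * ((η + 1 + 2 * k) / η) ^ 2 * n := by ring
        _ ≤ n * n := by
          gcongr
          exact (hVq.trans_le hVn).le
        _ = n ^ 2 := by ring
    rw [div_mul_eq_mul_div, div_le_iff₀ hη] at h1
    linarith
  have hval : total (clubValue k M η) l + (lam - k - η * (k - 1)) ≤
      expect (step k law x) (fun z => total (clubValue k M η) z.peers) := by
    rw [expect_step_total hlaw (c₁ := -((1 + η) * (k - 1))) (c₀ := 1)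
      (fun P hP => clubValue_eq_zero (by omega) hM hP), hs, hu]
    · have := le_expect_exchange_clubValue hM hη.le hη1 hlk h2n (by
        have := mul_le_mul_of_nonneg_left hYO (by positivity : (0 : ℝ) ≤ 1 + 2 * k)
        linarith)
      linarith
    · intro j
      have : ¬ {x.next + j} ⊆ M := fun h => by
        have := hMx _ (h (Finset.mem_singleton_self _))
        omega
      rw [clubValue, if_neg this, Finset.card_singleton, Nat.cast_sub (by omega), Nat.cast_one]
    · simp [clubValue]
  have hneed : expect (step k law x) (fun z => total (clubNeed k M) z.peers ^ 2) ≤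
      S ^ 2 + (1 + 2 * k) * a ^ 2 := by
    -- The need never increases in an exchange, so one factor of the square can be replaced by S;
    -- the rest is linear and its mean is known.
    have h1 : expect (step k law x) (fun z => total (clubNeed k M) z.peers ^ 2) ≤
        expect (exchange l) (fun l' => S * total (clubNeed k M) l' + (2 * a * S + a ^ 2)) := by
      rw [expect_step hlaw]
      refine expect_mono finite_support_exchange fun l' hl' => ?_
      refine expect_le_of_le hlaw fun b hb => ?_
      have h3 : total (clubNeed k M) (arrive k x.next l' b.1 b.2).peers ≤
          total (clubNeed k M) l' + A * k := by
        refine total_arrive_le (fun P hP => clubNeed_eq_zero hP) (fun P => ?_) (by positivity) _ _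
          (hA b hb)
        rw [clubNeed]
        split_ifs <;> (norm_cast; omega)
      have h4 : total (clubNeed k M) l' ≤ S :=
        total_le_of_mem_exchange (fun P c hc => clubNeed_insert_le P hc) hl'
      have h5 := total_nonneg' (clubNeed_nonneg (k := k) (M := M)) l'
      have h6 := total_nonneg' (clubNeed_nonneg (k := k) (M := M)) (arrive k x.next l' b.1 b.2).peers
      rw [mul_comm, ← ha] at h3
      have h7 := pow_le_pow_left₀ h6 h3 2
      have h8 := mul_le_mul_of_nonneg_right h4 h5
      have h9 := mul_le_mul_of_nonneg_left h4 ha0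
      linarith
    rw [expect_add finite_support_exchange, expect_const finite_support_exchange,
      expect_const_mul] at h1
    have h2 := expect_exchange_clubNeed_le hM hlk h2n
    have h3 : (n - F) * F / (n - 1) ≥ S / (2 * k) := by
      have hF2 : n / 2 ≤ F := by
        have h1 : 2 * η * (n - F) ≤ (η + 1 + 2 * k) * (n - F) := by
          gcongr
          linarith
        have h2 : η * (2 * (n - F)) ≤ η * n := by linarith
        have := le_of_mul_le_mul_left h2 hη
        linarith
      rw [ge_iff_le, div_le_div_iff₀ (by positivity) (by linarith)]
      calc S * (n - 1) ≤ (k * (n - F)) * (2 * F) := by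
            apply mul_le_mul hSO (by linarith) (by linarith) (by positivity)
        _ = _ := by ring
    have h4 : S * expect (exchange l) (total (clubNeed k M)) ≤ S * (S - S / (2 * k)) := by
      gcongr
      linarith
    -- The arithmetic-geometric inequality: the contraction S²/(2k) absorbs the cross term created
    -- by the arrivals.
    have h5 : 2 * a * S ≤ S * (S / (2 * k)) + 2 * k * a ^ 2 := by
      have : S * (S / (2 * k)) + 2 * k * a ^ 2 - 2 * a * S = (S - 2 * k * a) ^ 2 / (2 * k) := by
        field_simp
        ring
      have h6 : 0 ≤ (S - 2 * k * a) ^ 2 / (2 * k) := by positivity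
      linarith
    have h6 : S * (S - S / (2 * k)) = S ^ 2 - S * (S / (2 * k)) := by ring
    linarith
  have hfin := finite_support_step (k := k) (x := x) hlaw
  unfold clubPotential
  rw [expect_sub hfin, expect_div_const]
  have h8 : expect (step k law x) (fun z => total (clubNeed k M) z.peers ^ 2) / q ≤
      S ^ 2 / q + (lam - k - η * (k - 1)) := by
    rw [div_add' _ _ _ hq.ne']
    gcongr
    linarith
  linarith

/-- Instability. -/
theorem not_stable {law : PMF (ℕ × ℕ)} {lam : ℝ} (hk : 2 ≤ k) (hlaw : IsArrivalLaw lam law)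
    (hlam : k < lam) : ¬ Stable k law := by
  rintro ⟨x₀, -, hx₀⟩
  obtain ⟨A, hA⟩ := hlaw.bounded
  have hk' : (2 : ℝ) ≤ k := by exact_mod_cast hk
  have hmin : min 1 lam = 1 := min_eq_left (by linarith)
  have hs := hlaw.expect_served (by linarith)
  have hu := hlaw.expect_unserved (by linarith)
  rw [hmin] at hs hu
  -- Small enough for η(k - 1) to use up less than the excess λ - k.
  set η : ℝ := min 1 ((lam - k) / (2 * k)) with hη
  have hη0 : 0 < η := lt_min one_pos (div_pos (by linarith) (by linarith))
  have hη1 : η ≤ 1 := min_le_left _ _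
  have hdrift : 0 < lam - k - η * (k - 1) := by
    have h1 : η ≤ (lam - k) / (2 * k) := min_le_right _ _
    rw [le_div_iff₀ (by linarith)] at h1
    nlinarith
  set q : ℝ := (1 + 2 * k) * (k * A : ℝ) ^ 2 / (lam - k - η * (k - 1)) + 1 with hq
  have hq0 : 0 < q := by positivity
  have hqA : (1 + 2 * k) * (k * A : ℝ) ^ 2 ≤ q * (lam - k - η * (k - 1)) := by
    rw [hq, add_one_mul, div_mul_cancel₀ _ hdrift.ne']
    linarith
  set M := Finset.range (k - 1) with hM
  have hMc : M.card = k - 1 := by simp [hM]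
  -- Above c the potential does not decrease on average; on the target profile it is at most the
  -- number of peers, hence at most c.
  set c : ℝ := max (max 2 (q * ((η + 1 + 2 * k) / η) ^ 2)) x₀.peers.length with hc
  have hc0 : 0 ≤ c := (Nat.cast_nonneg _).trans (le_max_right _ _)
  have hfin := finite_support_of_bounded hA
  set B := {z : State | x₀.SameProfile z} with hB
  -- Optional stopping: the excess over c contributes nothing positive on the target, and elsewhere
  -- it is at most the population, which has grown by at most A per slot.
  have key : ∀ (n : ℕ) (x : State), x.Valid k → k - 1 ≤ x.next →
      clubPotential k M η q x - c ≤ (x.peers.length + A * n) * (avoid k law B n x).toReal := by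
    intro n
    induction n with
    | zero =>
      intro x _ _
      have := clubPotential_le (k := k) (M := M) hη0.le hq0 x
      simp only [avoid_zero_toReal, CharP.cast_eq_zero, mul_zero, add_zero, mul_one]
      linarith
    | succ n ih =>
      intro x hx hxn
      rcases le_or_gt (clubPotential k M η q x) c with hle | hgt
      · exact (sub_nonpos.2 hle).trans (by positivity)
      have h1 := clubPotential_le_expect hk hMc hη0 hη1 hA hs hu hq0 hqA hx
        (fun d hd => by rw [hM, Finset.mem_range] at hd; omega) ((le_max_left _ _).trans_lt hgt)
      rw [avoid_succ_toReal, ← expect_const_mul]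
      have hst := finite_support_step (k := k) (x := x) hfin
      refine le_trans (sub_le_sub_right h1 c) ?_
      rw [← expect_const hst c, ← expect_sub hst]
      refine expect_mono hst fun z hz => ?_
      have hlen : (z.peers.length : ℝ) ≤ x.peers.length + A := by
        exact_mod_cast length_le_of_mem_step hA hz
      by_cases hzB : z ∈ B
      · obtain ⟨σ, hσ⟩ := hzB
        have h3 : z.peers.length = x₀.peers.length := by simpa using hσ.length_eq
        have h4 := clubPotential_le (k := k) (M := M) hη0.le hq0 z
        rw [h3] at h4
        have h5 : (x₀.peers.length : ℝ) ≤ c := le_max_right _ _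
        have := avoidFrom_nonneg (k := k) (law := law) (B := B) n z
        exact (sub_nonpos.2 (h4.trans h5)).trans (by positivity)
      · have hzn : k - 1 ≤ z.next := by
          obtain ⟨l, _, a, _, rfl⟩ := mem_support_step.1 hz
          exact hxn.trans (Nat.le_add_right _ _)
        refine (ih z (hx.step hz) hzn).trans ?_
        rw [avoidFrom_of_notMem hzB]
        refine mul_le_mul_of_nonneg_right ?_ ENNReal.toReal_nonneg
        push_cast
        linarith
  obtain ⟨N, hN⟩ := exists_nat_gt c
  -- A pure club, for which the potential equals the number of peers.
  set y : State := ⟨k - 1, List.replicate N M⟩ with hy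
  have hyV : y.Valid k := by
    intro P hP
    rw [List.eq_of_mem_replicate hP]
    refine ⟨by omega, fun d hd => ?_⟩
    simpa [hM] using hd
  have hval : clubPotential k M η q y = N := by
    rw [clubPotential, total_replicate, total_replicate]
    simp [clubValue, clubNeed, hMc]
  refine hx₀ y hyV (meanTime_eq_top (a := y.peers.length) (A := A) (sub_pos.2 hN)
    (Nat.cast_nonneg _) fun n => ?_)
  rw [← hval]
  exact key n y hyV le_rfl

end

/-! ### Stability: weights measuring the effect of a club -/

/-- Number of chunks that a peer needs. -/
def need (k : ℕ) (P : Finset ℕ) : ℝ := ((k - P.card : ℕ) : ℝ)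

/-- Indicator of the peers present that do not hold exactly the chunks in `M`. -/
def outside (k : ℕ) (M P : Finset ℕ) : ℝ := if P.card < k ∧ P ≠ M then 1 else 0

/-- Indicator of the peers that hold exactly one chunk outside `M`. -/
def spreader (M P : Finset ℕ) : ℝ := if (P \ M).card = 1 then 1 else 0

/-- Number of useful downloads expected within `t` slots from a peer in contact with peers that
hold exactly the chunks in `M`, where `M` has `k - 1` elements. -/
def credit (k : ℕ) (M : Finset ℕ) (t : ℕ) (P : Finset ℕ) : ℝ :=
  if P ⊆ M then (min t (k - 1 - P.card) : ℕ) else 2 * (min t (k - P.card) : ℕ)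

/-- Probability that a peer selects a peer that holds exactly the chunks in `M`. -/
def clubFraction (M : Finset ℕ) (l : List (Finset ℕ)) : ℝ :=
  if 2 ≤ l.length then total (full M) l / (l.length - 1) else 0

section
variable {k : ℕ} {M : Finset ℕ} {l : List (Finset ℕ)}

lemma total_comm (φ : Finset ℕ → Finset ℕ → ℝ) (l : List (Finset ℕ)) :
    total (fun P => total (φ P) l) l = total (fun Q => total (fun P => φ P Q) l) l := by
  simp_rw [total_eq_sum]
  exact Finset.sum_comm

lemma need_nonneg (P : Finset ℕ) : 0 ≤ need k P := Nat.cast_nonneg _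

lemma need_le (P : Finset ℕ) : need k P ≤ k := by
  rw [need]; norm_cast; omega

lemma need_eq_zero {P : Finset ℕ} (h : k ≤ P.card) : need k P = 0 := by
  simp [need, Nat.sub_eq_zero_of_le h]

lemma need_insert {P : Finset ℕ} {c : ℕ} (hP : P.card < k) (hc : c ∉ P) :
    need k (insert c P) = need k P - 1 := by
  rw [need, need, Finset.card_insert_of_notMem hc,
    show k - P.card = (k - (P.card + 1)) + 1 by omega]
  push_cast
  ring

lemma need_insert_le {P : Finset ℕ} {c : ℕ} (hc : c ∉ P) : need k (insert c P) ≤ need k P := by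
  rw [need, need, Finset.card_insert_of_notMem hc]
  norm_cast; omega

lemma outside_le_one (P : Finset ℕ) : outside k M P ≤ 1 := by
  rw [outside]; split_ifs <;> norm_num

lemma spreader_nonneg (P : Finset ℕ) : 0 ≤ spreader M P := by
  rw [spreader]; split_ifs <;> norm_num

lemma spreader_le_one (P : Finset ℕ) : spreader M P ≤ 1 := by
  rw [spreader]; split_ifs <;> norm_num

lemma credit_nonneg (t : ℕ) (P : Finset ℕ) : 0 ≤ credit k M t P := by
  rw [credit]; split_ifs <;> positivity

lemma credit_zero (P : Finset ℕ) : credit k M 0 P = 0 := by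
  rw [credit]; split_ifs <;> simp

lemma credit_eq_zero (hk : 1 ≤ k) (hM : M.card = k - 1) (t : ℕ) {P : Finset ℕ} (hP : k ≤ P.card) :
    credit k M t P = 0 := by
  have : ¬ P ⊆ M := fun h => by have := Finset.card_le_card h; omega
  simp [credit, this, Nat.sub_eq_zero_of_le hP]

lemma credit_self (hM : M.card = k - 1) (t : ℕ) : credit k M t M = 0 := by
  simp [credit, hM]

lemma credit_le (hk : 1 ≤ k) (hM : M.card = k - 1) (t : ℕ) (P : Finset ℕ) :
    credit k M t P ≤ 2 * k * outside k M P := by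
  rw [outside]
  split_ifs with h
  · rw [mul_one, credit]
    split_ifs
    · norm_cast; omega
    · have : ((min t (k - P.card) : ℕ) : ℝ) ≤ k := by norm_cast; omega
      linarith
  · rw [not_and_or, not_lt, not_ne_iff] at h
    rcases h with h | rfl
    · simp [credit_eq_zero hk hM t h]
    · simp [credit_self hM]

lemma total_full_add_outside (h : ∀ P ∈ l, P.card < k) :
    total (full M) l + total (outside k M) l = l.length := by
  rw [← total_add, total_congr (g := fun _ => 1), total_const, mul_one]
  intro P hP
  by_cases hPM : P = M <;> simp [full, outside, hPM, h P hP]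

lemma total_full_nonneg : 0 ≤ total (full M) l := total_nonneg' (full_nonneg M) l

lemma total_full_le : total (full M) l ≤ l.length := by
  have := total_mono (l := l) fun P _ => full_le_one M P
  rwa [total_const, mul_one] at this

lemma clubFraction_nonneg : 0 ≤ clubFraction M l := by
  rw [clubFraction]
  split_ifs with h
  · have : (2 : ℝ) ≤ l.length := by exact_mod_cast h
    exact div_nonneg total_full_nonneg (by linarith)
  · exact le_rfl

/-- The factor 2 covers the states with fewer than two peers, where nobody is contacted: there at
most N/2 peers are full and the left side is not positive. -/
lemma le_clubFraction {N : ℝ} (hN : 2 ≤ N) (hl : l.length ≤ N) :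
    1 - 2 * ((N - total (full M) l) / N) ≤ clubFraction M l := by
  have h0 := total_full_nonneg (M := M) (l := l)
  have h1 := total_full_le (M := M) (l := l)
  have hd : (N - total (full M) l) / N = 1 - total (full M) l / N := by
    rw [sub_div, div_self (by linarith)]
  rw [hd, clubFraction]
  split_ifs with h
  · have h2 : (2 : ℝ) ≤ l.length := by exact_mod_cast h
    have h3 : total (full M) l / N ≤ total (full M) l / (l.length - 1) := by
      gcongr <;> linarith
    have h4 : total (full M) l / N ≤ 1 := by
      rw [div_le_one (by linarith)]; linarith
    linarith
  · have h2 : (l.length : ℝ) ≤ 1 := by norm_cast; omega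
    have h4 : total (full M) l / N ≤ 1 / 2 := by
      rw [div_le_div_iff₀ (by linarith) (by norm_num)]; linarith
    linarith

/-! ### Expected effect of the exchanges -/

lemma expect_contact_need_le (P Q : Finset ℕ) (hP : P.card < k) :
    expect (contact P Q) (need k) ≤ need k P - (if Q ⊆ P then 0 else 1) := by
  split_ifs with h
  · refine expect_contact_le (fun _ => by simp) fun c hc hcP => absurd (h hc) hcP
  · exact expect_contact_le (fun h' => absurd h' h) fun c _ hcP => (need_insert hP hcP).le

lemma expect_exchange_need_le (hl : ∀ P ∈ l, P.card < k) (h2 : 2 ≤ l.length) :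
    expect (exchange l) (total (need k)) ≤ total (need k) l -
      total (fun P => total (fun Q => if Q ⊆ P then 0 else 1) l) l / (l.length - 1) :=
  expect_exchange_total_le h2 (fun P hP Q _ => expect_contact_need_le P Q (hl P hP)) (by simp)

/-- An outsider that meets the club uses up one unit of credit by its own download. An infected peer
is granted a second unit, earned by the club members that contact it: the last term books that gain
to the member, and the two `infected` terms cancel after summation over ordered pairs. -/
lemma expect_contact_need_sub_credit_le (hM : M.card = k - 1) (t : ℕ) {P Q : Finset ℕ}
    (hP : P.card < k) :
    expect (contact P Q) (fun P' => need k P' - credit k M t P') ≤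
      need k P - (full M Q * (credit k M (t + 1) P - infected M P) + full M P * infected M Q) := by
  have hle : ∀ c ∉ P, need k (insert c P) - credit k M t (insert c P) ≤ need k P - 1 :=
    fun c hc => by
      have := credit_nonneg (k := k) (M := M) t (insert c P)
      rw [need_insert hP hc]
      linarith
  have hcr := credit_nonneg (k := k) (M := M) t P
  by_cases hPM : P = M
  · have h1 : full M P = 1 := by simp [full, hPM]
    have h2 : infected M P = 0 := by simp [infected, hPM]
    have h3 : credit k M (t + 1) P = 0 := by rw [hPM, credit_self hM]
    rw [h1, h2, h3]
    by_cases hQ : Q ⊆ M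
    · have h4 : infected M Q = 0 := by simp [infected, hQ]
      rw [h4]
      refine expect_contact_le (fun _ => by linarith) fun c hc hcP => ?_
      exact absurd (hPM ▸ hQ hc) hcP
    · have h4 : infected M Q = 1 := by simp [infected, hQ]
      rw [h4]
      refine expect_contact_le (fun h => absurd (hPM ▸ h) hQ) fun c hc hcP => ?_
      linarith [hle c hcP]
  · have h1 : full M P = 0 := by simp [full, hPM]
    by_cases hQ : Q = M
    · subst hQ
      have h2 : full Q Q = 1 := by simp [full]
      rw [h1, h2]
      refine expect_contact_le (fun h => absurd h (not_subset_of_card hM hP hPM))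
        fun c hc hcP => ?_
      rw [need_insert hP hcP]
      by_cases h : P ⊆ Q
      · have h3 := Finset.card_lt_card (h.ssubset_of_ne hPM)
        have h4 : infected Q P = 0 := by simp [infected, h]
        rw [h4, credit, if_pos (Finset.insert_subset hc h), credit, if_pos h,
          Finset.card_insert_of_notMem hcP,
          show min (t + 1) (k - 1 - P.card) = min t (k - 1 - (P.card + 1)) + 1 by omega]
        push_cast
        linarith
      · have h4 : infected Q P = 1 := by simp [infected, h]
        rw [h4, credit, if_neg (insert_not_subset h c), credit, if_neg h,
          Finset.card_insert_of_notMem hcP,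
          show min (t + 1) (k - P.card) = min t (k - (P.card + 1)) + 1 by omega]
        push_cast
        linarith
    · have h2 : full M Q = 0 := by simp [full, hQ]
      rw [h1, h2]
      exact expect_contact_le (fun _ => by linarith) fun c _ hcP => by linarith [hle c hcP]

lemma expect_exchange_need_sub_credit_le (hM : M.card = k - 1) (t : ℕ)
    (hl : ∀ P ∈ l, P.card < k) :
    expect (exchange l) (total fun P => need k P - credit k M t P) ≤
      total (need k) l - clubFraction M l * total (credit k M (t + 1)) l := by
  rw [clubFraction]
  split_ifs with h2
  · have h1 := expect_exchange_total_le h2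
      (fun P hP Q _ => expect_contact_need_sub_credit_le (M := M) (Q := Q) hM t (hl P hP)) (by
        intro P _
        by_cases hP : P = M
        · simp [hP, full, infected, credit_self hM]
        · simp [full, hP])
    simp only [total_add, total_sub, total_mul_const, total_const_mul] at h1
    refine h1.trans_eq ?_
    ring
  · rw [expect_exchange_total_of_length_lt (not_le.1 h2), total_sub]
    have := total_nonneg' (credit_nonneg (k := k) (M := M) t) l
    linarith

/-- Only the downloads of club members from spreaders are counted; each spreader is contacted by
`clubFraction` members on average. -/
lemma expect_exchange_need_le_spreader (hl : ∀ P ∈ l, P.card < k) :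
    expect (exchange l) (total (need k)) ≤
      total (need k) l - clubFraction M l * total (spreader M) l := by
  rw [clubFraction]
  split_ifs with h2
  · have h1 := expect_exchange_total_le (f := need k) (f₀ := need k)
      (φ := fun P Q => full M P * spreader M Q) h2 (by
        intro P hP Q _
        refine (expect_contact_need_le P Q (hl P hP)).trans ?_
        refine sub_le_sub_left ?_ _
        by_cases hPM : P = M
        · subst hPM
          have := spreader_le_one (M := P) Q
          split_ifs with h
          · simp [spreader, Finset.sdiff_eq_empty_iff_subset.2 h]
          · simpa [full] using this
        · simp only [full, hPM, if_false, zero_mul]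
          split_ifs <;> norm_num) (by
        intro P _
        by_cases hP : P = M
        · simp [hP, spreader]
        · simp [full, hP])
    simp only [total_mul_const, total_const_mul] at h1
    refine h1.trans_eq ?_
    ring
  · rw [expect_exchange_total_of_length_lt (not_le.1 h2)]
    simp

/-- A peer leaves the club only by contacting one of the n - F others, so the mean loss is at most F
(n - F) / (n - 1), and F ≤ n ≤ 2 (n - 1). -/
lemma le_expect_exchange_full {N : ℝ} (hl : l.length ≤ N) :
    total (full M) l - 2 * (N - total (full M) l) ≤ expect (exchange l) (total (full M)) := by
  have hF := total_full_le (M := M) (l := l)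
  rcases lt_or_ge l.length 2 with h2 | h2
  · rw [expect_exchange_total_of_length_lt h2]
    linarith
  · have h1 := expect_exchange_total_le (f := fun P => -full M P) (f₀ := fun P => -full M P)
      (φ := fun P Q => -(full M P * (1 - full M Q))) h2 (by
        intro P _ Q _
        by_cases hPM : P = M
        · subst hPM
          by_cases hQ : Q = P
          · subst hQ
            exact expect_contact_le (fun _ => by simp [full]) fun c hc hcP => absurd hc hcP
          · refine expect_contact_le (fun _ => by simp [full, hQ]) fun c _ _ => ?_
            have := full_nonneg P (insert c P)
            simp only [full, hQ] at this ⊢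
            simpa using this
        · refine expect_contact_le (fun _ => by simp [full, hPM]) fun c _ _ => ?_
          have := full_nonneg M (insert c P)
          simp only [full, hPM] at this ⊢
          simpa using this) (by
        intro P _
        by_cases hP : P = M <;> simp [full, hP])
    simp only [total_neg, total_mul_const, total_const_mul, total_sub, total_const, mul_one] at h1
    rw [expect_exchange_total_neg] at h1
    have h2' : (2 : ℝ) ≤ l.length := by exact_mod_cast h2
    have h3 : total (full M) l * (l.length - total (full M) l) / (l.length - 1) ≤
        2 * (N - total (full M) l) := by
      rw [div_le_iff₀ (by linarith)]
      calc total (full M) l * (l.length - total (full M) l)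
          ≤ (2 * (l.length - 1)) * (N - total (full M) l) := by
            apply mul_le_mul <;> linarith
        _ = _ := by ring
    rw [neg_div] at h1
    linarith

lemma spreader_insert {P : Finset ℕ} {c : ℕ} (hc : c ∈ M) :
    spreader M (insert c P) = spreader M P := by
  rw [spreader, Finset.insert_sdiff_of_mem _ hc, spreader]

/-- A spreader that contacts the club can only obtain chunks of M, and so remains a spreader. -/
lemma clubFraction_le_expect_download_spreader (i : Fin l.length)
    (hi : spreader M (l.get i) = 1) :
    clubFraction M l ≤ expect (download l i) (spreader M) := by
  rw [clubFraction]
  split_ifs with h2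
  · have hne : l.get i ≠ M := by
      intro h
      rw [h] at hi
      simp [spreader] at hi
    have h1 := le_expect_download (f := spreader M) (φ := full M) h2 i (by
      intro Q _
      by_cases hQ : Q = M
      · subst hQ
        refine le_expect_contact (fun _ => by rw [hi]; simp [full]) fun c hc _ => ?_
        rw [spreader_insert hc, hi]
        simp [full]
      · refine le_expect_contact (fun _ => ?_) fun c hc _ => ?_ <;>
        simp only [full, hQ, if_false] <;> exact spreader_nonneg _)
    have h3 : full M (l.get i) = 0 := by rw [full, if_neg hne]
    rwa [h3, sub_zero] at h1
  · exact le_expect_of_le (finite_support_download i) fun P _ => spreader_nonneg P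

/-- Some of the present spreaders, at most `K` of them, persist. -/
lemma exists_persistent_spreaders (M : Finset ℕ) (l : List (Finset ℕ)) (K : ℕ) :
    ∃ J : List (Finset ℕ) → ℝ,
      (∀ l' ∈ (exchange l).support, J l' ≤ total (spreader M) l') ∧
      (∀ l' ∈ (exchange l).support, J l' ≤ min (total (spreader M) l) K) ∧
      clubFraction M l * min (total (spreader M) l) K ≤ expect (exchange l) J := by
  classical
  set I := Finset.univ.filter fun i : Fin l.length => (l.get i \ M).card = 1 with hI
  have htot : total (spreader M) l = I.card := by
    rw [total_eq_sum]
    simp [spreader, hI]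
  -- Following a fixed set of at most K spreaders keeps the count below the cap in every outcome, so
  -- the cap costs nothing in expectation.
  obtain ⟨I₀, hI₀, hcard⟩ := Finset.exists_subset_card_eq (min_le_left I.card K)
  have hcard' : min (total (spreader M) l) K = I₀.card := by
    rw [htot, hcard]
    push_cast
    rfl
  have helim : ∀ (l' : List (Finset ℕ)) (i : ℕ), 0 ≤ (l'[i]?).elim 0 (spreader M) ∧
      (l'[i]?).elim 0 (spreader M) ≤ 1 := by
    intro l' i
    cases l'[i]? with
    | none => simp
    | some P => exact ⟨spreader_nonneg P, spreader_le_one P⟩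
  refine ⟨fun l' => ∑ i ∈ I₀, (l'[i.1]?).elim 0 (spreader M), ?_, ?_, ?_⟩
  · intro l' hl'
    rw [total_eq_sum_getElem? (length_of_mem_exchange hl')]
    exact Finset.sum_le_sum_of_subset_of_nonneg (Finset.subset_univ _) fun i _ _ => (helim l' i).1
  · intro l' _
    rw [hcard']
    exact (Finset.sum_le_sum fun (i : Fin l.length) _ => (helim l' i).2).trans_eq (by simp)
  · rw [hcard', expect_sum finite_support_exchange, mul_comm, ← nsmul_eq_mul]
    refine Finset.card_nsmul_le_sum _ _ _ fun i hi => ?_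
    have h1 : expect (exchange l) (fun l' => (l'[i.1]?).elim 0 (spreader M)) =
        expect (download l i) (spreader M) := by
      rw [exchange, expect_independent _ _ i.1 (by simp)]
      · simp
      · intro p hp
        obtain ⟨i, rfl⟩ := (List.mem_ofFn' _ _).1 hp
        exact finite_support_download i
    rw [h1]
    refine clubFraction_le_expect_download_spreader i ?_
    have := hI₀ hi
    rw [hI, Finset.mem_filter] at this
    rw [spreader, if_pos this.2]

/-- If few downloads are useful, then almost all the peers hold the same chunks. -/
lemma exists_club {R : ℝ} (h2 : 2 ≤ l.length)
    (hR : total (fun P => total (fun Q => if Q ⊆ P then 0 else 1) l) l / (l.length - 1) < R) :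
    ∃ M ∈ l, total (outside k M) l ≤ 2 * R := by
  by_contra! hcon
  have h2' : (2 : ℝ) ≤ l.length := by exact_mod_cast h2
  have h0 : 0 ≤ total (fun P => total (fun Q => if Q ⊆ P then 0 else 1) l) l :=
    total_nonneg' (fun P => total_nonneg' (fun Q => by split_ifs <;> norm_num) l) l
  have h1 : l.length * (2 * R) ≤ total (fun P => total (outside k P) l) l := by
    rw [← total_const]
    exact total_mono fun P hP => (hcon P hP).le
  -- Of two distinct chunk sets, at least one is not contained in the other, so one of the two
  -- contacts is useful.
  have h3 : total (fun P => total (outside k P) l) l ≤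
      total (fun P => total (fun Q => (if Q ⊆ P then (0 : ℝ) else 1) +
        (if P ⊆ Q then (0 : ℝ) else 1)) l) l := by
    refine total_mono fun P _ => total_mono fun Q _ => ?_
    rw [outside]
    by_cases h : Q = P
    · simp [h]
    · by_cases h' : Q ⊆ P
      · have : ¬ P ⊆ Q := fun h'' => h (subset_antisymm h' h'')
        simp only [h', this, if_true, if_false]
        split_ifs <;> norm_num
      · simp only [h', if_false]
        split_ifs <;> norm_num
  simp_rw [total_add] at h3
  rw [← total_comm fun P Q => if Q ⊆ P then (0 : ℝ) else 1] at h3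
  rw [div_lt_iff₀ (by linarith)] at hR
  have hR0 : 0 < R := pos_of_mul_pos_left (h0.trans_lt hR) (by linarith)
  linarith

end

/-! ### Stability: drift of the total need over several slots -/

/-- Number of chunks that the peers present need in total. -/
def totalNeed (k : ℕ) (x : State) : ℝ := total (need k) x.peers

/-- Solution of `e (t + 1) = 3 * e t + c` with `e 0 = 0`. -/
def errorCoeff (c : ℝ) : ℕ → ℝ
  | 0 => 0
  | t + 1 => 3 * errorCoeff c t + c

lemma errorCoeff_nonneg {c : ℝ} (hc : 0 ≤ c) (t : ℕ) : 0 ≤ errorCoeff c t := by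
  induction t with
  | zero => exact le_rfl
  | succ t ih => rw [errorCoeff]; positivity

/-- Fraction of a reference number `N` of peers that do not hold exactly the chunks in `M`. -/
def defect (N : ℝ) (M : Finset ℕ) (x : State) : ℝ := (N - total (full M) x.peers) / N

/-- Mean growth in a slot of the total need, less the credit for `t` more slots, due to the new
peers. -/
def arrivalGrowth (k : ℕ) (s u : ℝ) (t : ℕ) : ℝ :=
  s * (k - 1 - 2 * (min t (k - 1) : ℕ)) + u * (k - (min t (k - 1) : ℕ))

section
variable {k A : ℕ} {M : Finset ℕ} {law : PMF (ℕ × ℕ)} {x : State}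

lemma totalNeed_nonneg (x : State) : 0 ≤ totalNeed k x := total_nonneg' need_nonneg _

lemma totalNeed_arrive_le (n : ℕ) (l : List (Finset ℕ)) {g u : ℕ} (h : g + u ≤ A) :
    totalNeed k (arrive k n l g u) ≤ total (need k) l + k * A := by
  rw [mul_comm]
  exact total_arrive_le (fun P hP => need_eq_zero hP) need_le (by positivity) _ _ h

lemma expect_step_totalNeed_le (hA : ∀ a ∈ law.support, a.1 + a.2 ≤ A) :
    expect (step k law x) (totalNeed k) ≤
      expect (exchange x.peers) (total (need k)) + k * A := by
  have hlaw := finite_support_of_bounded hA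
  rw [expect_step hlaw, ← expect_const (finite_support_exchange (l := x.peers)) (k * A : ℝ),
    ← expect_add finite_support_exchange]
  exact expect_mono finite_support_exchange fun l _ => expect_le_of_le hlaw fun a ha =>
    totalNeed_arrive_le _ _ (hA a ha)

lemma expect_exchange_need_le_self (l : List (Finset ℕ)) :
    expect (exchange l) (total (need k)) ≤ total (need k) l :=
  expect_le_of_le finite_support_exchange fun _ hl' =>
    total_le_of_mem_exchange (fun _ _ hc => need_insert_le hc) hl'

lemma expect_iter_totalNeed_le (hA : ∀ a ∈ law.support, a.1 + a.2 ≤ A) (t : ℕ) (x : State) :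
    expect (iter k law t x) (totalNeed k) ≤ totalNeed k x + k * A * t := by
  have hlaw := finite_support_of_bounded hA
  have h := expect_iter_le (k := k) (law := law) (I := fun _ _ => True)
    (Φ := fun t x => totalNeed k x + k * A * t) hlaw (fun _ _ _ _ _ => trivial)
    (fun t x _ => by
      rw [expect_add (finite_support_step hlaw), expect_const (finite_support_step hlaw)]
      have h1 := expect_step_totalNeed_le (k := k) (x := x) hA
      have h2 := expect_exchange_need_le_self (k := k) x.peers
      rw [← totalNeed] at h2
      push_cast
      linarith) t x trivial
  simpa using h

/-- Losses of the club at most triple N - F on average; arrivals can only add to the club, and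
departures do not touch it. Keeping N fixed throughout the T slots makes the bound iterate. -/
lemma expect_step_defect_le (hlaw : law.support.Finite) {N : ℝ} (hN : 0 < N) (hM : M.card < k)
    (hMx : ∀ c ∈ M, c < x.next) (hx : x.peers.length ≤ N) :
    expect (step k law x) (defect N M) ≤ 3 * defect N M x := by
  have h1 : expect (exchange x.peers) (total (full M)) ≤
      expect (step k law x) (fun z => total (full M) z.peers) := by
    rw [expect_step_total hlaw (c₁ := 0) (c₀ := full M ∅) _ _ rfl]
    · have h0 : 0 ≤ expect law (fun a => (a.2 : ℝ)) :=
        le_expect_of_le hlaw fun a _ => Nat.cast_nonneg _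
      have := mul_nonneg h0 (full_nonneg M ∅)
      linarith
    · intro P hP
      rw [full, if_neg]
      rintro rfl
      omega
    · intro j
      rw [full, if_neg]
      rintro rfl
      have := hMx _ (Finset.mem_singleton_self _)
      omega
  have h2 := le_expect_exchange_full (M := M) hx
  have hst := finite_support_step (k := k) (x := x) hlaw
  unfold defect
  rw [expect_div_const, expect_sub hst, expect_const hst, ← mul_div_assoc]
  gcongr
  linarith

lemma not_singleton_subset (hMx : ∀ c ∈ M, c < x.next) (j : ℕ) : ¬ {x.next + j} ⊆ M :=
  fun h => by
    have := hMx _ (h (Finset.mem_singleton_self _))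
    omega

lemma next_le_of_mem_step {z : State} (hz : z ∈ (step k law x).support) : x.next ≤ z.next := by
  obtain ⟨l, _, a, _, rfl⟩ := mem_support_step.1 hz
  exact Nat.le_add_right _ _

lemma total_outside_le_of_mem_step (hA : ∀ a ∈ law.support, a.1 + a.2 ≤ A) (hM : k ≤ M.card + 1)
    {z : State} (hz : z ∈ (step k law x).support) :
    total (outside k M) z.peers ≤ total (outside k M) x.peers + A := by
  obtain ⟨l, hl, a, ha, rfl⟩ := mem_support_step.1 hz
  have h1 : total (outside k M) l ≤ total (outside k M) x.peers := by
    refine total_le_of_mem_exchange (fun P c hc => ?_) hl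
    rw [outside, outside, Finset.card_insert_of_notMem hc]
    by_cases h : P.card < k ∧ P ≠ M
    · rw [if_pos h]
      split_ifs <;> norm_num
    · rw [if_neg h, if_neg]
      rintro ⟨h1, _⟩
      refine h ⟨by omega, ?_⟩
      rintro rfl
      omega
  have h2 := total_arrive_le (k := k) (f := outside k M)
    (fun P hP => by simp [outside, hP]) outside_le_one
    zero_le_one x.next l (hA a ha)
  linarith

/-- The potential is the total need less the credit for the slots left. If every contact hit the
club, only the growth due to arrivals would remain. A contact hits the club with probability at
least 1 minus twice the defect, and the credits sum to at most 2kb, whence an error of 4kb times the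
defect per slot; `errorCoeff` adds these up. -/
lemma expect_iter_totalNeed_le_of_saturated {s u N b : ℝ} (hk : 2 ≤ k) (hM : M.card = k - 1)
    (hA : ∀ a ∈ law.support, a.1 + a.2 ≤ A)
    (hs : expect law (fun a => (a.1 : ℝ)) = s) (hu : expect law (fun a => (a.2 : ℝ)) = u)
    (hN : 2 ≤ N) (hb : 0 ≤ b) (T : ℕ) (hx : x.Valid k) (hMx : ∀ c ∈ M, c < x.next)
    (hxN : x.peers.length + A * T ≤ N) (hxb : total (outside k M) x.peers + A * T ≤ b) :
    expect (iter k law T x) (totalNeed k) ≤ totalNeed k x +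
      errorCoeff (4 * k * b) T * defect N M x + ∑ t ∈ Finset.range T, arrivalGrowth k s u t := by
  have hlaw := finite_support_of_bounded hA
  have hc : 0 ≤ 4 * k * b := by positivity
  have h := expect_iter_le (k := k) (law := law)
    (I := fun t z => z.Valid k ∧ (∀ c ∈ M, c < z.next) ∧ z.peers.length + A * t ≤ N ∧
      total (outside k M) z.peers + A * t ≤ b)
    (Φ := fun t z => total (fun P => need k P - credit k M t P) z.peers +
      errorCoeff (4 * k * b) t * defect N M z + ∑ i ∈ Finset.range t, arrivalGrowth k s u i)
    hlaw ?_ ?_ T x ⟨hx, hMx, hxN, hxb⟩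
  · have h0 : ∀ z : State, total (fun P => need k P - credit k M 0 P) z.peers +
        errorCoeff (4 * k * b) 0 * defect N M z +
        ∑ i ∈ Finset.range 0, arrivalGrowth k s u i = totalNeed k z := by
      intro z
      simp [credit_zero, errorCoeff, totalNeed]
    simp_rw [h0] at h
    refine h.trans ?_
    have h1 : total (fun P => need k P - credit k M T P) x.peers ≤ totalNeed k x :=
      total_mono fun P _ => by linarith [credit_nonneg (k := k) (M := M) T P]
    linarith
  · rintro t x ⟨h1, h2, h3, h4⟩ z hz
    refine ⟨h1.step hz, fun c hc => (h2 c hc).trans_le (next_le_of_mem_step hz), ?_, ?_⟩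
    · have : (z.peers.length : ℝ) ≤ x.peers.length + A := by
        exact_mod_cast length_le_of_mem_step hA hz
      push_cast at h3
      linarith
    · have := total_outside_le_of_mem_step hA (M := M) (by omega) hz
      push_cast at h4
      linarith
  · rintro t x ⟨h1, h2, h3, h4⟩
    have hst := finite_support_step (k := k) (x := x) hlaw
    have hlk : ∀ P ∈ x.peers, P.card < k := fun P hP => (h1 P hP).1
    have hAt : (0 : ℝ) ≤ A * (t + 1 : ℕ) := by positivity
    have hxN : (x.peers.length : ℝ) ≤ N := by linarith
    rw [expect_add hst, expect_add hst, expect_const_mul, expect_const hst,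
      expect_step_total hlaw (c₁ := k - 1 - 2 * (min t (k - 1) : ℕ))
        (c₀ := k - (min t (k - 1) : ℕ)), hs, hu, Finset.sum_range_succ, errorCoeff, ← arrivalGrowth]
    · have e1 := expect_exchange_need_sub_credit_le (M := M) hM t hlk
      have e2 := expect_step_defect_le (k := k) hlaw (by linarith) (by omega) h2 hxN
      have e3 := le_clubFraction (M := M) hN hxN
      rw [← defect] at e3
      have e4 := mul_le_mul_of_nonneg_left e2 (errorCoeff_nonneg hc t)
      have e5 : total (credit k M (t + 1)) x.peers ≤ 2 * k * b := by
        refine (total_mono fun P _ => credit_le (by omega) hM (t + 1) P).trans ?_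
        rw [total_const_mul]
        gcongr
        linarith
      have e6 := total_nonneg' (credit_nonneg (k := k) (M := M) (t + 1)) x.peers
      have e7 := mul_le_mul_of_nonneg_right e3 e6
      have e8 : 0 ≤ defect N M x :=
        div_nonneg (by linarith [total_full_le (M := M) (l := x.peers)]) (by linarith)
      have e9 := mul_le_mul_of_nonneg_left e5 e8
      rw [total_sub]
      linarith
    · intro P hP
      rw [need_eq_zero hP, credit_eq_zero (by omega) hM t hP, sub_zero]
    · intro j
      rw [credit, if_neg (not_singleton_subset h2 j), need, Finset.card_singleton,
        Nat.cast_sub (by omega), Nat.cast_one]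
    · rw [credit, if_pos (Finset.empty_subset M), need]
      simp

/-- A spreader has at most |M| + 1 < k chunks and thus never departs; a served newcomer is a
spreader because its chunk is fresh. -/
lemma total_spreader_arrive (hM : M.card + 1 < k) (hMx : ∀ c ∈ M, c < x.next)
    (l : List (Finset ℕ)) (g u : ℕ) :
    total (spreader M) (arrive k x.next l g u).peers = total (spreader M) l + g := by
  have h1 : ∀ j, spreader M {x.next + j} = 1 := by
    intro j
    rw [spreader, if_pos]
    rw [Finset.sdiff_eq_self_of_disjoint, Finset.card_singleton]
    rw [Finset.disjoint_singleton_left]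
    exact fun h => not_singleton_subset hMx j (by simpa using h)
  have h0 : spreader M ∅ = 0 := by simp [spreader]
  rw [total_arrive]
  · simp [h1, h0]
  · intro P hP
    rw [spreader, if_neg]
    intro h
    have := Finset.le_card_sdiff M P
    omega

lemma le_expect_step_spreader (hlaw : law.support.Finite) (hM : M.card + 1 < k)
    (hMx : ∀ c ∈ M, c < x.next) (K : ℕ) :
    clubFraction M x.peers * min (total (spreader M) x.peers) K +
      (if total (spreader M) x.peers < K then
        expect law (fun a => if 1 ≤ a.1 then 1 else 0) else 0) ≤
      expect (step k law x) (fun z => min (total (spreader M) z.peers) K) := by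
  obtain ⟨J, hJ1, hJ2, hJ3⟩ := exists_persistent_spreaders M x.peers K
  rw [expect_step hlaw]
  refine (add_le_add_left hJ3 _).trans ?_
  rw [← expect_const (finite_support_exchange (l := x.peers)) (ite _ _ _),
    ← expect_add finite_support_exchange]
  refine expect_mono finite_support_exchange fun l hl => ?_
  have h1 := hJ1 l hl
  have h2 := hJ2 l hl
  have h3 : J l + (if total (spreader M) x.peers < K then
        expect law (fun a => if 1 ≤ a.1 then 1 else 0) else 0) =
      expect law (fun a => J l + (if total (spreader M) x.peers < K then
        (if 1 ≤ a.1 then 1 else 0) else 0)) := by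
    rw [expect_add hlaw, expect_const hlaw]
    split_ifs
    · rfl
    · rw [expect_const hlaw]
  rw [h3]
  refine expect_mono hlaw fun a _ => ?_
  rw [total_spreader_arrive hM hMx]
  have h4 : J l ≤ K := h2.trans (min_le_right _ _)
  have h5 : J l ≤ total (spreader M) x.peers := h2.trans (min_le_left _ _)
  have h6 : (0 : ℝ) ≤ a.1 := Nat.cast_nonneg _
  refine le_min ?_ ?_
  · split_ifs with ha hb
    · have : (1 : ℝ) ≤ a.1 := by exact_mod_cast hb
      linarith
    · linarith
    · linarith
  · split_ifs with ha hb
    · have h7 : total (spreader M) x.peers + 1 ≤ K := by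
        -- The number of spreaders is an integer, so being below the cap leaves room for a whole
        -- one.
        obtain ⟨m, hm⟩ : ∃ m : ℕ, total (spreader M) x.peers = m := by
          refine ⟨(x.peers.map fun P => if (P \ M).card = 1 then 1 else 0).sum, ?_⟩
          rw [total, Nat.cast_list_sum, List.map_map]
          congr 1
          refine List.map_congr_left fun P _ => ?_
          simp [spreader]
        rw [hm] at ha ⊢
        exact_mod_cast ha
      linarith
    · linarith
    · linarith

/-- With K = kA + 1 spreaders, the downloads of club members from them outweigh the need kA that
arrivals can add. Before that, a new spreader comes with positive probability in each slot, and the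
potential κ (K - min(spreaders, K)) pays for the wait. Contacts that miss the club cost up to 2K
times the defect in downloads, and κ times as much in lost spreaders. -/
lemma expect_iter_totalNeed_le_of_unsaturated {N κ : ℝ} (hM : M.card + 1 < k)
    (hA : ∀ a ∈ law.support, a.1 + a.2 ≤ A) (hκ0 : 0 ≤ κ)
    (hκ : k * A + 1 ≤ κ * expect law (fun a => if 1 ≤ a.1 then 1 else 0))
    (hN : 2 ≤ N) (T : ℕ) (hx : x.Valid k) (hMx : ∀ c ∈ M, c < x.next)
    (hxN : x.peers.length + A * T ≤ N) :
    expect (iter k law T x) (totalNeed k) ≤ totalNeed k x + κ * (k * A + 1) +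
      errorCoeff (2 * (k * A + 1) * (1 + κ)) T * defect N M x - T := by
  have hlaw := finite_support_of_bounded hA
  have hc : 0 ≤ 2 * (k * A + 1) * (1 + κ) := by positivity
  set K : ℕ := k * A + 1 with hK
  have hKr : (k * A + 1 : ℝ) = K := by rw [hK]; push_cast; rfl
  rw [hKr] at hκ hc ⊢
  set c := 2 * (K : ℝ) * (1 + κ) with hcdef
  have h := expect_iter_le (k := k) (law := law)
    (I := fun t z => z.Valid k ∧ (∀ c ∈ M, c < z.next) ∧ z.peers.length + A * t ≤ N)
    (Φ := fun t z => totalNeed k z + κ * (K - min (total (spreader M) z.peers) K) +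
      errorCoeff c t * defect N M z - t)
    hlaw ?_ ?_ T x ⟨hx, hMx, hxN⟩
  · refine le_trans (expect_mono (finite_support_iter hlaw T x) fun z _ => ?_) (h.trans ?_)
    · have : 0 ≤ κ * (K - min (total (spreader M) z.peers) K) :=
        mul_nonneg hκ0 (sub_nonneg.2 (min_le_right _ _))
      simp only [errorCoeff, zero_mul, Nat.cast_zero]
      linarith
    · have h1 : 0 ≤ κ * min (total (spreader M) x.peers) K :=
        mul_nonneg hκ0 (le_min (total_nonneg' spreader_nonneg _) (Nat.cast_nonneg _))
      linarith
  · rintro t x ⟨h1, h2, h3⟩ z hz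
    refine ⟨h1.step hz, fun c hc => (h2 c hc).trans_le (next_le_of_mem_step hz), ?_⟩
    have : (z.peers.length : ℝ) ≤ x.peers.length + A := by
      exact_mod_cast length_le_of_mem_step hA hz
    push_cast at h3
    linarith
  · rintro t x ⟨h1, h2, h3⟩
    have hst := finite_support_step (k := k) (x := x) hlaw
    have hlk : ∀ P ∈ x.peers, P.card < k := fun P hP => (h1 P hP).1
    have hAt : (0 : ℝ) ≤ A * (t + 1 : ℕ) := by positivity
    have hxN : (x.peers.length : ℝ) ≤ N := by linarith
    rw [expect_sub hst, expect_add hst, expect_add hst, expect_const_mul, expect_const_mul,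
      expect_const hst, expect_sub hst, expect_const hst, errorCoeff]
    have e1 := expect_step_totalNeed_le (k := k) (x := x) hA
    have e2 := expect_exchange_need_le_spreader (M := M) hlk
    have e3 := expect_step_defect_le (k := k) hlaw (by linarith) (by omega) h2 hxN
    have e4 := mul_le_mul_of_nonneg_left e3 (errorCoeff_nonneg hc t)
    have e5 := le_expect_step_spreader hlaw hM h2 K
    have e6 := le_clubFraction (M := M) hN hxN
    rw [← defect] at e6
    set G := total (spreader M) x.peers with hG
    set m := min G K with hm
    have hG0 : 0 ≤ G := total_nonneg' spreader_nonneg _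
    have hm0 : 0 ≤ m := le_min hG0 (Nat.cast_nonneg _)
    have hmK : m ≤ K := min_le_right _ _
    have e8 : 0 ≤ defect N M x :=
      div_nonneg (by linarith [total_full_le (M := M) (l := x.peers)]) (by linarith)
    have e9 : m - 2 * K * defect N M x ≤ clubFraction M x.peers * m := by
      have := mul_le_mul_of_nonneg_right e6 hm0
      have := mul_le_mul_of_nonneg_left hmK e8
      linarith
    have e10 : clubFraction M x.peers * m ≤ clubFraction M x.peers * G :=
      mul_le_mul_of_nonneg_left (min_le_left _ _) clubFraction_nonneg
    have e11 := mul_le_mul_of_nonneg_left e5 hκ0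
    have e12 := mul_le_mul_of_nonneg_left e9 hκ0
    rw [← totalNeed] at e2
    rw [mul_add] at e11
    -- Either the cap is reached, or the expected new spreader, valued at κ, already pays K.
    have e13 : (K : ℝ) ≤ m + κ * (if G < K then
        expect law (fun a => if 1 ≤ a.1 then 1 else 0) else 0) := by
      split_ifs with hlt
      · linarith
      · rw [hm, min_eq_right (not_lt.1 hlt)]
        linarith
    rw [hcdef]
    push_cast
    linarith

/-- With at least k - 1 slots left, a newcomer's credit is no longer truncated: an unserved one adds
1 to the potential and a served one removes k - 1. -/
lemma sum_arrivalGrowth (hk : 1 ≤ k) (s u : ℝ) (j : ℕ) :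
    ∑ t ∈ Finset.range (k - 1 + j), arrivalGrowth k s u t =
      ∑ t ∈ Finset.range (k - 1), arrivalGrowth k s u t + j * (u - (k - 1) * s) := by
  induction j with
  | zero => simp
  | succ j ih =>
    rw [← add_assoc, Finset.sum_range_succ, ih, arrivalGrowth,
      min_eq_right (by omega : k - 1 ≤ k - 1 + j), Nat.cast_sub hk]
    push_cast
    ring

/-- Negative drift of the total need over a number of slots, from all states with many peers. -/
lemma exists_drift {s u : ℝ} (hk : 2 ≤ k) (hA : ∀ a ∈ law.support, a.1 + a.2 ≤ A)
    (hs : expect law (fun a => (a.1 : ℝ)) = s) (hu : expect law (fun a => (a.2 : ℝ)) = u)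
    (hq : 0 < expect law (fun a => if 1 ≤ a.1 then 1 else 0))
    (hsu : u < (k - 1) * s) :
    ∃ T N : ℕ, ∀ x : State, x.Valid k → N ≤ x.peers.length →
      expect (iter k law T x) (totalNeed k) ≤ totalNeed k x - 1 := by
  have hlaw := finite_support_of_bounded hA
  set κ : ℝ := (k * A + 1) / expect law (fun a => if 1 ≤ a.1 then 1 else 0) with hκ
  have hκ0 : 0 ≤ κ := by positivity
  have hκ1 : (k * A + 1 : ℝ) ≤ κ * expect law (fun a => if 1 ≤ a.1 then 1 else 0) := by
    rw [hκ, div_mul_cancel₀ _ hq.ne']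
  set σ := ∑ t ∈ Finset.range (k - 1), arrivalGrowth k s u t with hσ
  -- The lower bound j₁ serves a club of k - 1 chunks and j₂ a smaller one; both aim at a drift of
  -- -2, so that 1 is left for the errors.
  obtain ⟨j₁, hj₁⟩ := exists_nat_ge ((σ + 2) / ((k - 1) * s - u))
  obtain ⟨j₂, hj₂⟩ := exists_nat_ge (κ * (k * A + 1) + 2)
  set j := max j₁ j₂ with hj
  set T := k - 1 + j with hT
  have hgrowth : ∑ t ∈ Finset.range T, arrivalGrowth k s u t ≤ -2 := by
    rw [hT, sum_arrivalGrowth (by omega), ← hσ]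
    have h1 : (σ + 2) / ((k - 1) * s - u) ≤ j := hj₁.trans (by exact_mod_cast le_max_left _ _)
    rw [div_le_iff₀ (by linarith)] at h1
    linarith
  have hT2 : κ * (k * A + 1) + 2 ≤ T := by
    refine hj₂.trans ?_
    have : j₂ ≤ T := (le_max_right j₁ j₂).trans (Nat.le_add_left _ _)
    exact_mod_cast this
  have hT1 : 1 ≤ T := by omega
  -- With R useful downloads in the first slot, the arrivals of all T slots are outweighed by 1.
  set R : ℝ := k * A * T + 1 with hR
  have hR0 : 0 ≤ R := by positivity
  set b : ℝ := 2 * R + A * T with hb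
  have hb0 : 0 ≤ b := by positivity
  set e₁ := errorCoeff (4 * k * b) T with he₁
  set e₂ := errorCoeff (2 * (k * A + 1) * (1 + κ)) T with he₂
  have he₁0 : 0 ≤ e₁ := errorCoeff_nonneg (by positivity) T
  have he₂0 : 0 ≤ e₂ := errorCoeff_nonneg (by positivity) T
  -- The numerator of the defect is at most b, so both error terms together are at most 1 for this
  -- many peers.
  obtain ⟨N, hN⟩ := exists_nat_ge (max 2 ((e₁ + e₂) * b))
  refine ⟨T, N, fun x hx hxN => ?_⟩
  have hxN' : max 2 ((e₁ + e₂) * b) ≤ x.peers.length := hN.trans (by exact_mod_cast hxN)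
  obtain ⟨h2, hbig⟩ := max_le_iff.1 hxN'
  have h2l : 2 ≤ x.peers.length := by exact_mod_cast h2
  have hlk : ∀ P ∈ x.peers, P.card < k := fun P hP => (hx P hP).1
  rcases lt_or_ge (total (fun P => total (fun Q => if Q ⊆ P then 0 else 1) x.peers) x.peers /
    (x.peers.length - 1)) R with hlt | hge
  · obtain ⟨M, hM, hMo⟩ := exists_club (k := k) h2l hlt
    set n : ℝ := x.peers.length + A * T with hn
    have hAT : (0 : ℝ) ≤ A * T := by positivity
    have hn0 : 0 < n := by linarith
    have hdef : (e₁ + e₂) * defect n M x ≤ 1 := by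
      have h4 := total_full_add_outside (M := M) hlk
      rw [defect, ← mul_div_assoc, div_le_one hn0]
      have h5 : n - total (full M) x.peers ≤ b := by linarith
      have := mul_le_mul_of_nonneg_left h5 (add_nonneg he₁0 he₂0)
      linarith
    have hdef0 : 0 ≤ defect n M x :=
      div_nonneg (by linarith [total_full_le (M := M) (l := x.peers)]) hn0.le
    have hMx := (hx M hM).2
    have hMk := (hx M hM).1
    have h6 := mul_nonneg he₁0 hdef0
    have h7 := mul_nonneg he₂0 hdef0
    by_cases hsat : M.card = k - 1
    · have := expect_iter_totalNeed_le_of_saturated (N := n) (b := b) hk hsat hA hs hu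
        (by linarith) hb0 T hx hMx le_rfl (by linarith)
      linarith
    · have := expect_iter_totalNeed_le_of_unsaturated (N := n) (M := M) (by omega) hA hκ0 hκ1
        (by linarith) T hx hMx le_rfl
      linarith
  · obtain ⟨t, ht⟩ : ∃ t, T = t + 1 := ⟨T - 1, by omega⟩
    have hst := finite_support_step (k := k) (x := x) hlaw
    have e1 := expect_step_totalNeed_le (k := k) (x := x) hA
    have e2 := expect_exchange_need_le hlk h2l
    have e3 : expect (iter k law T x) (totalNeed k) ≤
        expect (step k law x) (totalNeed k) + k * A * t := by
      rw [ht, expect_iter_succ hlaw, ← expect_const hst (k * A * t : ℝ), ← expect_add hst]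
      exact expect_mono hst fun z _ => expect_iter_totalNeed_le hA t z
    have e4 : R = k * A * t + k * A + 1 := by
      rw [hR, ht]
      push_cast
      ring
    rw [← totalNeed] at e2
    linarith

end

/-! ### Foster's criterion with a multi-slot drift and a reachable set -/

section
variable {k A : ℕ} {law : PMF (ℕ × ℕ)} {x y : State} {B : Set State} {a : ℕ × ℕ}

/-- The set `B` can be reached from a state within `s` slots, when the numbers of served and of
unserved new peers in these slots are given by `a`. -/
def Reach (k : ℕ) (a : ℕ × ℕ) (B : Set State) : ℕ → State → Prop
  | 0, x => x ∈ B
  | s + 1, x => x ∈ B ∨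
      ∃ l ∈ (exchange x.peers).support, Reach k a B s (arrive k x.next l a.1 a.2)

lemma reach_of_mem (h : x ∈ B) (s : ℕ) : Reach k a B s x := by
  cases s with
  | zero => exact h
  | succ s => exact Or.inl h

lemma apply_mul_le_expect {α : Type} {p : PMF α} (hp : p.support.Finite) {f : α → ℝ}
    (hf : ∀ a, 0 ≤ f a) (a : α) : (p a).toReal * f a ≤ expect p f := by
  by_cases ha : a ∈ p.support
  · rw [expect_eq_sum (s := hp.toFinset) (by simp)]
    exact Finset.single_le_sum (f := fun a => (p a).toReal * f a)
      (fun b _ => mul_nonneg ENNReal.toReal_nonneg (hf b)) (by simpa using ha)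
  · rw [PMF.mem_support_iff, not_not] at ha
    rw [ha, ENNReal.toReal_zero, zero_mul]
    exact le_expect_of_le hp fun b _ => hf b

lemma avoid_succ_le {s N : ℕ} (hk : 1 ≤ k) (hlaw : law.support.Finite) {p : ℝ} (hp : 0 ≤ p)
    (hx : x.Valid k) (hN : x.peers.length ≤ N) (hN1 : 1 ≤ N)
    {l : List (Finset ℕ)} (hl : l ∈ (exchange x.peers).support)
    (h : avoidFrom k law B s (arrive k x.next l a.1 a.2) ≤ 1 - p) :
    (avoid k law B (s + 1) x).toReal ≤
      1 - (((N : ENNReal)⁻¹ * (k : ENNReal)⁻¹) ^ N * law a).toReal * p := by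
  set z := arrive k x.next l a.1 a.2 with hz
  set b : ENNReal := (N : ENNReal)⁻¹ * (k : ENNReal)⁻¹ with hb
  have hb1 : b ≤ 1 := mul_le_one' (ENNReal.inv_le_one.2 (by exact_mod_cast hN1))
    (ENNReal.inv_le_one.2 (by exact_mod_cast hk))
  have hst := finite_support_step (k := k) (x := x) hlaw
  have h1 : b ^ N * law a ≤ step k law x z := by
    rw [step, PMF.bind_apply]
    refine le_trans ?_ (ENNReal.le_tsum l)
    gcongr
    · exact (pow_le_pow_right_of_le_one' hb1 hN).trans
        (le_exchange_apply hk hN (fun P hP => (hx P hP).1.le) hl)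
    · rw [PMF.map_apply]
      refine le_trans ?_ (ENNReal.le_tsum a)
      rw [if_pos hz]
  have h2 : (b ^ N * law a).toReal ≤ (step k law x z).toReal :=
    ENNReal.toReal_mono ((step k law x).apply_ne_top z) h1
  have h3 := apply_mul_le_expect hst (f := fun z => 1 - avoidFrom k law B s z)
    (fun z => sub_nonneg.2 (avoidFrom_le_one s z)) z
  rw [expect_sub hst, expect_const hst] at h3
  have h4 : (b ^ N * law a).toReal * p ≤ (step k law x z).toReal * (1 - avoidFrom k law B s z) :=
    mul_le_mul h2 (by linarith) hp ENNReal.toReal_nonneg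
  rw [avoid_succ_toReal]
  linarith

lemma toReal_pos_of_mem_support (hk : 1 ≤ k) (N : ℕ) (ha : a ∈ law.support) :
    0 < (((N : ENNReal)⁻¹ * (k : ENNReal)⁻¹) ^ N * law a).toReal := by
  rw [ENNReal.toReal_mul]
  refine mul_pos ?_ (ENNReal.toReal_pos ((PMF.mem_support_iff _ _).1 ha) (law.apply_ne_top a))
  rcases Nat.eq_zero_or_pos N with rfl | hN
  · simp
  · rw [ENNReal.toReal_pow, ENNReal.toReal_mul, ENNReal.toReal_inv, ENNReal.toReal_inv]
    have : (0 : ℝ) < k := by exact_mod_cast hk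
    have : (0 : ℝ) < N := by exact_mod_cast hN
    simp only [ENNReal.toReal_natCast]
    positivity

/-- A scenario of s slots has a probability bounded below uniformly over the states with boundedly
many peers; the recursion passes to N + A because the population may grow by A in a slot. -/
lemma exists_avoidFrom_le (hk : 1 ≤ k) (hA : ∀ a ∈ law.support, a.1 + a.2 ≤ A)
    (ha : a ∈ law.support) (s N : ℕ) :
    ∃ p : ℝ, 0 < p ∧ ∀ x : State, x.Valid k → x.peers.length ≤ N → Reach k a B s x →
      avoidFrom k law B s x ≤ 1 - p := by
  have hlaw := finite_support_of_bounded hA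
  induction s generalizing N with
  | zero => exact ⟨1, one_pos, fun x _ _ hx => by rw [avoidFrom_of_mem hx]; norm_num⟩
  | succ s ih =>
    obtain ⟨p, hp, h⟩ := ih (N + A)
    -- The bound N + 1 keeps the inverse at most 1 even if N = 0.
    have hpos := toReal_pos_of_mem_support hk (N + 1) ha
    set c := ((((N + 1 : ℕ) : ENNReal)⁻¹ * (k : ENNReal)⁻¹) ^ (N + 1) * law a).toReal with hc
    refine ⟨min 1 (c * p), lt_min one_pos (mul_pos hpos hp), fun x hx hN hr => ?_⟩
    by_cases hxB : x ∈ B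
    · rw [avoidFrom_of_mem hxB]
      linarith [min_le_left 1 (c * p)]
    obtain ⟨l, hl, hr⟩ := hr.resolve_left hxB
    have hz : arrive k x.next l a.1 a.2 ∈ (step k law x).support :=
      mem_support_step.2 ⟨l, hl, a, ha, rfl⟩
    have h1 := h _ (hx.step hz) ((length_le_of_mem_step hA hz).trans (by omega)) hr
    have h2 := avoid_succ_le (N := N + 1) hk hlaw hp.le hx (by omega) (by omega) hl h1
    rw [avoidFrom_of_notMem hxB]
    linarith [min_le_right 1 (c * p)]

/-- Finite mean hitting times, from a negative drift over `T` slots outside the states with few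
peers, and from the possibility to reach `B` from all states. -/
theorem meanTime_ne_top_of_drift_of_reach {T N s : ℕ} (hk : 1 ≤ k)
    (hA : ∀ a ∈ law.support, a.1 + a.2 ≤ A) (ha : a ∈ law.support)
    (hdrift : ∀ x : State, x.Valid k → N ≤ x.peers.length →
      expect (iter k law T x) (totalNeed k) ≤ totalNeed k x - 1)
    (hreach : ∀ x : State, x.Valid k → ∃ l ∈ (exchange x.peers).support,
      Reach k a B s (arrive k x.next l a.1 a.2)) (hy : y.Valid k) :
    meanTime k law B y ≠ ⊤ := by
  have hlaw := finite_support_of_bounded hA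
  obtain ⟨p, hp, hpx⟩ := exists_avoidFrom_le (k := k) (B := B) hk hA ha s (N + A)
  set c := ((((N + 1 : ℕ) : ENNReal)⁻¹ * (k : ENNReal)⁻¹) ^ (N + 1) * law a).toReal with hc
  have hc0 : 0 < c := toReal_pos_of_mem_support hk (N + 1) ha
  have hhit : ∀ x : State, x.Valid k → x.peers.length ≤ N →
      (avoid k law B (s + 1) x).toReal ≤ 1 - c * p := by
    intro x hx hN
    obtain ⟨l, hl, hr⟩ := hreach x hx
    have hz : arrive k x.next l a.1 a.2 ∈ (step k law x).support :=
      mem_support_step.2 ⟨l, hl, a, ha, rfl⟩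
    exact avoid_succ_le (N := N + 1) hk hlaw hp.le hx (by omega) (by omega) hl
      (hpx _ (hx.step hz) ((length_le_of_mem_step hA hz).trans (by omega)) hr)
  -- From a state with few peers the need may grow by kAT over T slots; β makes the chance c p of
  -- hitting the target within s + 1 slots pay for this and 1 more.
  set β : ℝ := (k * A * T + 1) / (c * p) with hβ
  have hβ0 : 0 ≤ β := by positivity
  have hβ1 : β * (c * p) = k * A * T + 1 := div_mul_cancel₀ _ (mul_pos hc0 hp).ne'
  -- Under one slot both sums telescope: the first changes by the T-slot drift of the need, the
  -- second by minus the probability of hitting the target within s + 1 slots.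
  refine meanTime_ne_top_of_drift (I := State.Valid k)
    (V := fun x => ∑ t ∈ Finset.range T, expect (iter k law t x) (totalNeed k) +
      β * ∑ j ∈ Finset.range (s + 1), (avoid k law B j x).toReal) hlaw
    (fun x hx z hz => hx.step hz) (fun x _ => ?_) (fun x hx => ?_) hy
  · refine add_nonneg (Finset.sum_nonneg fun t _ => ?_)
      (mul_nonneg hβ0 (Finset.sum_nonneg fun j _ => ENNReal.toReal_nonneg))
    exact le_expect_of_le (finite_support_iter hlaw t x) fun z _ => totalNeed_nonneg z
  · have hst := finite_support_step (k := k) (x := x) hlaw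
    have hW0 : ∀ z, 0 ≤ ∑ t ∈ Finset.range T, expect (iter k law t z) (totalNeed k) :=
      fun z => Finset.sum_nonneg fun t _ =>
        le_expect_of_le (finite_support_iter hlaw t z) fun z _ => totalNeed_nonneg z
    have h1 : expect (step k law x) (Bᶜ.indicator fun x =>
        ∑ t ∈ Finset.range T, expect (iter k law t x) (totalNeed k) +
          β * ∑ j ∈ Finset.range (s + 1), (avoid k law B j x).toReal) ≤
        expect (step k law x) (fun z =>
          ∑ t ∈ Finset.range T, expect (iter k law t z) (totalNeed k) +
          β * ∑ j ∈ Finset.range (s + 1), avoidFrom k law B j z) := by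
      refine expect_mono hst fun z _ => ?_
      by_cases hz : z ∈ B
      · simpa [hz, avoidFrom_of_mem hz] using hW0 z
      · simp [hz, avoidFrom_of_notMem hz]
    rw [expect_add hst, expect_const_mul, expect_sum hst, expect_sum hst] at h1
    simp_rw [← avoid_succ_toReal, ← expect_iter_succ hlaw] at h1
    have h2 := Finset.sum_range_succ' (fun t => expect (iter k law t x) (totalNeed k)) T
    rw [Finset.sum_range_succ, expect_iter_zero] at h2
    have h3 := Finset.sum_range_succ' (fun j => (avoid k law B j x).toReal) (s + 1)
    rw [Finset.sum_range_succ, avoid_zero_toReal] at h3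
    have h4 : ∑ j ∈ Finset.range (s + 1), (avoid k law B (j + 1) x).toReal =
        ∑ j ∈ Finset.range (s + 1), (avoid k law B j x).toReal -
          (1 - (avoid k law B (s + 1) x).toReal) := by linarith
    rw [h4, mul_sub] at h1
    rcases le_total N x.peers.length with hN | hN
    · have h5 := hdrift x hx hN
      have h6 : 0 ≤ β * (1 - (avoid k law B (s + 1) x).toReal) :=
        mul_nonneg hβ0 (sub_nonneg.2 (avoid_toReal_le_one _ _))
      linarith
    · have h5 := expect_iter_totalNeed_le (k := k) hA T x
      have h6 : β * (c * p) ≤ β * (1 - (avoid k law B (s + 1) x).toReal) :=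
        mul_le_mul_of_nonneg_left (by linarith [hhit x hx hN]) hβ0
      linarith

end

/-! ### A profile that can be reached from every state -/

section
variable {k g u n : ℕ} {B : Set State} {l l' : List (Finset ℕ)}

/-- The new peers of a slot, without the first one, when `g` of them are served, beginning with
chunk `n`, and `u` are not. -/
def cohortTail (g u n : ℕ) : List (Finset ℕ) :=
  (List.range (g - 1)).map (fun j => {n + 1 + j}) ++ List.replicate u ∅

lemma mem_cohortTail {P : Finset ℕ} :
    P ∈ cohortTail g u n ↔ (∃ j < g - 1, P = {n + 1 + j}) ∨ (u ≠ 0 ∧ P = ∅) := by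
  simp only [cohortTail, List.mem_append, List.mem_map, List.mem_range, List.mem_replicate,
    eq_comm (b := P)]

lemma peers_arrive (hk : 2 ≤ k) (hg : 1 ≤ g) (n : ℕ) (l : List (Finset ℕ)) (u : ℕ) :
    (arrive k n l g u).peers =
      (l.filter fun P => decide (P.card < k)) ++ {n} :: cohortTail g u n := by
  have h1 : (List.range g).map (fun j => ({n + j} : Finset ℕ)) ++ List.replicate u ∅ =
      {n} :: cohortTail g u n := by
    obtain ⟨m, rfl⟩ := Nat.exists_eq_add_of_le' hg
    rw [List.range_succ_eq_map, cohortTail]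
    simp only [List.map_cons, List.map_map, add_zero, List.cons_append, Nat.add_sub_cancel]
    congr 2
    refine List.map_congr_left fun j _ => ?_
    simp only [Function.comp, Nat.succ_eq_add_one]
    congr 1
    omega
  rw [arrive]
  simp only
  rw [List.append_assoc, h1, List.filter_append]
  congr 1
  rw [List.filter_eq_self]
  intro P hP
  rw [decide_eq_true_eq]
  rcases List.mem_cons.1 hP with rfl | hP
  · rw [Finset.card_singleton]; omega
  · rcases mem_cohortTail.1 hP with ⟨j, _, rfl⟩ | ⟨_, rfl⟩
    · rw [Finset.card_singleton]; omega
    · rw [Finset.card_empty]; omega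

lemma insert_mem_support_contact (P : Finset ℕ) (n : ℕ) :
    insert n P ∈ (contact P {n}).support := by
  rw [mem_support_contact]
  by_cases h : n ∈ P
  · exact Or.inl ⟨by simpa using h, Finset.insert_eq_of_mem h⟩
  · exact Or.inr ⟨n, by simp, h, rfl⟩

/-- It is possible that all the other peers contact a peer that holds one chunk only. -/
lemma mem_support_exchange_of_contact {rest tail : List (Finset ℕ)} {Q R : Finset ℕ}
    (hQ : Q ∈ rest ++ tail) (hR : R ∈ (contact {n} Q).support) :
    rest.map (insert n) ++ R :: tail.map (insert n) ∈
      (exchange (rest ++ {n} :: tail)).support := by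
  have hp : rest.length < (rest ++ {n} :: tail).length := by simp
  -- Everybody contacts the holder of {n}, except that holder, which cannot contact itself and turns
  -- to Q.
  have hl' : rest.map (insert n) ++ R :: tail.map (insert n) =
      ((rest ++ {n} :: tail).map (insert n)).set rest.length R := by
    rw [List.map_append, List.set_append_right _ _ (by simp)]
    simp
  rw [hl', mem_support_exchange]
  refine ⟨by simp, fun i => ?_⟩
  rw [mem_support_download]
  right
  simp only [List.get_eq_getElem, Fin.val_cast, List.getElem_set, List.getElem_map]
  by_cases hi : rest.length = i.1
  · have hi' : i = ⟨rest.length, hp⟩ := Fin.ext hi.symm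
    subst hi'
    rw [if_pos rfl]
    rcases List.mem_append.1 hQ with hQ | hQ
    · obtain ⟨j, hj, rfl⟩ := List.getElem_of_mem hQ
      refine ⟨⟨j, by simp; omega⟩, ?_, ?_⟩
      · simp only [ne_eq, Fin.mk.injEq]; omega
      · simpa [List.getElem_append_left hj] using hR
    · obtain ⟨j, hj, rfl⟩ := List.getElem_of_mem hQ
      refine ⟨⟨rest.length + (j + 1), by simp; omega⟩, ?_, ?_⟩
      · simp only [ne_eq, Fin.mk.injEq]; omega
      · simpa using hR
  · rw [if_neg hi]
    refine ⟨⟨rest.length, hp⟩, fun h => hi (congrArg Fin.val h), ?_⟩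
    simpa using insert_mem_support_contact _ n

lemma lt_of_mem_exchange {x : State} (hx : x.Valid k) (hl : l ∈ (exchange x.peers).support)
    {P : Finset ℕ} (hP : P ∈ l) {c : ℕ} (hc : c ∈ P) : c < x.next := by
  obtain ⟨P₀, hP₀, rfl | ⟨Q, hQ, d, hd, _, rfl⟩⟩ := exists_of_mem_exchange hl hP
  · exact (hx _ hP₀).2 c hc
  · rcases Finset.mem_insert.1 hc with rfl | hc
    exacts [(hx _ hQ).2 _ hd, (hx _ hP₀).2 c hc]

lemma exists_superset_of_mem_exchange (hl' : l' ∈ (exchange l).support) {P : Finset ℕ}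
    (hP : P ∈ l) : ∃ P' ∈ l', P ⊆ P' ∧ P'.card ≤ P.card + 1 := by
  obtain ⟨hlen, h⟩ := mem_support_exchange.1 hl'
  obtain ⟨i, hi, rfl⟩ := List.getElem_of_mem hP
  refine ⟨_, List.get_mem l' (Fin.cast hlen.symm ⟨i, hi⟩), ?_⟩
  rcases (mem_support_download _ _).1 (h ⟨i, hi⟩) with ⟨_, h2⟩ | ⟨j, _, hc⟩
  · rw [h2]
    exact ⟨subset_rfl, Nat.le_succ _⟩
  · rcases mem_support_contact.1 hc with ⟨_, h2⟩ | ⟨c, _, h2, h3⟩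
    · rw [h2]
      exact ⟨subset_rfl, Nat.le_succ _⟩
    · rw [h3]
      exact ⟨Finset.subset_insert _ _, Finset.card_insert_le _ _⟩

/-- The peers that arrived in the last `j` slots but the last one, beginning with chunk `b`, if in
each slot the first new peer of the preceding slot is contacted by all the others, and obtains the
chunks in `R n`, where `n` is its first chunk. -/
def layers (k g u : ℕ) (R : ℕ → Finset ℕ) : ℕ → ℕ → List (Finset ℕ)
  | 0, _ => []
  | j + 1, b => ((layers k g u R j b).map (insert (b + g * j)) ++
      R (b + g * j) :: (cohortTail g u (b + g * j)).map (insert (b + g * j))).filter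
        fun P => decide (P.card < k)

/-- The state of peers that all arrived recently. -/
def recent (k g u : ℕ) (R : ℕ → Finset ℕ) (b : ℕ) : List (Finset ℕ) :=
  layers k g u R k b ++ {b + g * k} :: cohortTail g u (b + g * k)

variable {R : ℕ → Finset ℕ}

/-- In each slot all old peers take the fresh chunk of the first newcomer of the preceding slot, so
each gains exactly one chunk and is gone after k slots. What remains depends only on the chunk
numbers. `Av` is the invariant ensuring that the contacted newcomer itself finds a peer from which
its chunk set becomes `R n`. -/
lemma reach_of_layers {Av : ℕ → List (Finset ℕ) → Prop} {b : ℕ} (hk : 2 ≤ k) (hg : 1 ≤ g)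
    (hav : ∀ n rest, Av n rest →
      ∃ Q ∈ rest ++ cohortTail g u n, R n ∈ (contact {n} Q).support)
    (hnext : ∀ n rest, ((R n).card < k → R n ∈ rest) → Av (n + g) rest)
    (hB : ∀ z : State, z.peers = recent k g u R b → z ∈ B) (j i : ℕ) (old : List (Finset ℕ))
    (x : State) (hij : i + j = k) (hxn : x.next = b + g * (i + 1))
    (hxp : x.peers = (old ++ layers k g u R i b) ++ {b + g * i} :: cohortTail g u (b + g * i))
    (hold : ∀ P ∈ old, P.card < k ∧ i ≤ P.card ∧ ∀ c ∈ P, c < b + g * i)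
    (hAv : Av (b + g * i) (old ++ layers k g u R i b)) : Reach k (g, u) B j x := by
  induction j generalizing i old x with
  | zero =>
    -- An old peer would now hold at least k chunks, and so none is left.
    obtain rfl : i = k := by omega
    refine hB x ?_
    have : old = [] := List.eq_nil_iff_forall_not_mem.2 fun P hP => by
      have := hold P hP
      omega
    rw [hxp, this, List.nil_append, recent]
  | succ j ih =>
    obtain ⟨Q, hQ, hR⟩ := hav _ _ hAv
    refine Or.inr ⟨_, hxp ▸ mem_support_exchange_of_contact hQ hR, ?_⟩
    refine ih (i + 1) ((old.map (insert (b + g * i))).filter fun P => decide (P.card < k)) _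
      (by omega) ?_ ?_ ?_ ?_
    · change x.next + g = _
      rw [hxn]
      ring
    · rw [peers_arrive hk hg, hxn, List.map_append, List.append_assoc, List.filter_append, layers]
    · intro P hP
      rw [List.mem_filter, List.mem_map, decide_eq_true_eq] at hP
      obtain ⟨⟨P₀, hP₀, rfl⟩, hcard⟩ := hP
      obtain ⟨h1, h2, h3⟩ := hold P₀ hP₀
      have hn : b + g * i ∉ P₀ := fun h => (h3 _ h).false
      refine ⟨hcard, ?_, fun c hc => ?_⟩
      · rw [Finset.card_insert_of_notMem hn]
        omega
      · have : b + g * i < b + g * (i + 1) := by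
          rw [mul_add]; omega
        rcases Finset.mem_insert.1 hc with rfl | hc
        · exact this
        · exact (h3 c hc).trans this
    · rw [show b + g * (i + 1) = b + g * i + g by ring]
      refine hnext _ _ fun h => List.mem_append_right _ ?_
      rw [layers, List.mem_filter, decide_eq_true_eq]
      exact ⟨by simp, h⟩

lemma lt_of_mem_layers (hg : 1 ≤ g) {b : ℕ} (hb : 1 ≤ b)
    (hR : ∀ n, 1 ≤ n → ∀ c ∈ R n, c < n + g) (j : ℕ) {P : Finset ℕ}
    (hP : P ∈ layers k g u R j b) {c : ℕ} (hc : c ∈ P) : c < b + g * j := by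
  induction j generalizing P with
  | zero => simp [layers] at hP
  | succ j ih =>
    rw [show b + g * (j + 1) = b + g * j + g by ring]
    simp only [layers, List.mem_filter, List.mem_append, List.mem_map, List.mem_cons] at hP
    rcases hP.1 with ⟨P₀, hP₀, rfl⟩ | rfl | ⟨P₀, hP₀, rfl⟩
    · rcases Finset.mem_insert.1 hc with rfl | hc
      · omega
      · have := ih hP₀ hc
        omega
    · exact hR _ (by omega) c hc
    · rcases Finset.mem_insert.1 hc with rfl | hc
      · omega
      · rcases mem_cohortTail.1 hP₀ with ⟨i, hi, rfl⟩ | ⟨_, rfl⟩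
        · rw [Finset.mem_singleton] at hc
          omega
        · simp at hc

lemma card_lt_of_mem_layers (j b : ℕ) {P : Finset ℕ} (hP : P ∈ layers k g u R j b) :
    P.card < k := by
  cases j with
  | zero => simp [layers] at hP
  | succ j => simpa using (List.mem_filter.1 hP).2

lemma mem_recent {b : ℕ} (hk : 2 ≤ k) (hg : 1 ≤ g) (hb : 1 ≤ b)
    (hR : ∀ n, 1 ≤ n → ∀ c ∈ R n, c < n + g) {P : Finset ℕ} (hP : P ∈ recent k g u R b) :
    P.card < k ∧ ∀ c ∈ P, c < b + g * k + g := by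
  rw [recent, List.mem_append, List.mem_cons] at hP
  rcases hP with hP | rfl | hP
  · exact ⟨card_lt_of_mem_layers _ _ hP, fun c hc =>
      (lt_of_mem_layers hg hb hR _ hP hc).trans_le (Nat.le_add_right _ _)⟩
  · refine ⟨by rw [Finset.card_singleton]; omega, fun c hc => ?_⟩
    rw [Finset.mem_singleton] at hc
    omega
  · rcases mem_cohortTail.1 hP with ⟨i, hi, rfl⟩ | ⟨_, rfl⟩
    · refine ⟨by rw [Finset.card_singleton]; omega, fun c hc => ?_⟩
      rw [Finset.mem_singleton] at hc
      omega
    · refine ⟨by rw [Finset.card_empty]; omega, fun c hc => by simp at hc⟩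

lemma cohortTail_add (d : ℕ) :
    cohortTail g u (n + d) = (cohortTail g u n).map (Finset.map (addRightEmbedding d)) := by
  simp only [cohortTail, List.map_append, List.map_map, List.map_replicate, Finset.map_empty]
  congr 1
  refine List.map_congr_left fun j _ => ?_
  simp only [Function.comp, Finset.map_singleton, addRightEmbedding_apply]
  congr 1
  omega

/-- The construction commutes with shifts of the chunk numbers, so the profile finally reached does
not depend on the starting state. The restriction to n ≥ 1 allows for a choice of `R` that involves
n - 1. -/
lemma layers_add {b : ℕ} (hb : 1 ≤ b) (hR : ∀ n, 1 ≤ n → ∀ d,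
    R (n + d) = (R n).map (addRightEmbedding d)) (d j : ℕ) :
    layers k g u R j (b + d) = (layers k g u R j b).map (Finset.map (addRightEmbedding d)) := by
  induction j with
  | zero => rfl
  | succ j ih =>
    have h : (layers k g u R j (b + d)).map (insert (b + d + g * j)) ++ R (b + d + g * j) ::
        (cohortTail g u (b + d + g * j)).map (insert (b + d + g * j)) =
        ((layers k g u R j b).map (insert (b + g * j)) ++ R (b + g * j) ::
          (cohortTail g u (b + g * j)).map (insert (b + g * j))).map
            (Finset.map (addRightEmbedding d)) := by
      rw [ih, show b + d + g * j = b + g * j + d by ring, hR _ (by omega), cohortTail_add]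
      simp [Function.comp_def, Finset.map_insert]
    rw [layers, layers, h, List.filter_map]
    simp [Function.comp_def]

lemma recent_add {b : ℕ} (hb : 1 ≤ b) (hR : ∀ n, 1 ≤ n → ∀ d,
    R (n + d) = (R n).map (addRightEmbedding d)) (d : ℕ) :
    recent k g u R (b + d) = (recent k g u R b).map (Finset.map (addRightEmbedding d)) := by
  rw [recent, recent, layers_add hb hR, show b + d + g * k = b + g * k + d by ring, cohortTail_add]
  simp

/-- A nonzero shift is not a permutation of ℕ, but its restriction to the finitely many names in use
extends to one. -/
lemma exists_perm_add (m d : ℕ) : ∃ σ : Equiv.Perm ℕ, ∀ i < m, σ i = i + d := by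
  obtain ⟨σ, hσ⟩ := Equiv.Perm.exists_extending_pair (fun i : Fin m => i.1)
    (fun i : Fin m => i.1 + d) Fin.val_injective (fun i j h => Fin.ext (by simpa using h))
  exact ⟨σ, fun i hi => hσ ⟨i, hi⟩⟩

lemma sameProfile_of_map_add {x z : State} {d m : ℕ} (hx : ∀ P ∈ x.peers, ∀ c ∈ P, c < m)
    (hz : z.peers = x.peers.map (Finset.map (addRightEmbedding d))) : x.SameProfile z := by
  obtain ⟨σ, hσ⟩ := exists_perm_add m d
  refine ⟨σ, List.Perm.of_eq ?_⟩
  rw [hz]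
  refine List.map_congr_left fun P hP => ?_
  ext c
  simp only [Finset.mem_map, addRightEmbedding_apply, Equiv.coe_toEmbedding]
  constructor
  · rintro ⟨e, he, rfl⟩
    exact ⟨e, he, hσ e (hx P hP e he)⟩
  · rintro ⟨e, he, rfl⟩
    exact ⟨e, he, (hσ e (hx P hP e he)).symm⟩

/-- A profile that can be reached from all states, when the first new peer of each slot can obtain
a fixed set of chunks, up to a shift. -/
lemma exists_reach_of_layers {Av : ℕ → List (Finset ℕ) → Prop} (hk : 2 ≤ k) (hg : 1 ≤ g)
    (hav : ∀ n rest, Av n rest →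
      ∃ Q ∈ rest ++ cohortTail g u n, R n ∈ (contact {n} Q).support)
    (hnext : ∀ n rest, ((R n).card < k → R n ∈ rest) → Av (n + g) rest)
    (hinit : ∀ n rest, (∃ P ∈ rest, n ∈ P ∧ P.card ≤ 2 ∧ P.card < k) ∨ k = 2 → Av (n + g) rest)
    (hRlt : ∀ n, 1 ≤ n → ∀ c ∈ R n, c < n + g)
    (hR : ∀ n, 1 ≤ n → ∀ d, R (n + d) = (R n).map (addRightEmbedding d)) :
    ∃ (x : State) (s : ℕ), x.Valid k ∧ ∀ y : State, y.Valid k →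
      ∃ l ∈ (exchange y.peers).support,
        Reach k (g, u) {z | x.SameProfile z} s (arrive k y.next l g u) := by
  refine ⟨⟨1 + g * k + g, recent k g u R 1⟩, k + 1, fun P hP => mem_recent hk hg le_rfl hRlt hP,
    fun y hy => ?_⟩
  obtain ⟨l₁, hl₁⟩ := (exchange y.peers).support_nonempty
  refine ⟨l₁, hl₁, ?_⟩
  set z := arrive k y.next l₁ g u with hz
  have hzV : z.Valid k := hy.step (law := PMF.pure (g, u))
    (mem_support_step.2 ⟨l₁, hl₁, (g, u), by simp, rfl⟩)
  -- A second unconstrained slot: if k ≥ 3, the first newcomer of the slot before then has at most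
  -- two chunks, is still present, and provides the initial case of `Av`.
  obtain ⟨l₂, hl₂⟩ := (exchange z.peers).support_nonempty
  refine Or.inr ⟨l₂, hl₂, ?_⟩
  have hzn : z.next = y.next + g := rfl
  refine reach_of_layers (Av := Av) (b := y.next + g) hk hg hav hnext (fun w hw => ?_) k 0
    (l₂.filter fun P => decide (P.card < k)) _ (by omega) ?_ ?_ ?_ ?_
  · obtain ⟨d, hd⟩ := Nat.exists_eq_add_of_le (by omega : 1 ≤ y.next + g)
    refine sameProfile_of_map_add (d := d) (fun P hP => (mem_recent hk hg le_rfl hRlt hP).2) ?_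
    rw [hw, hd, recent_add le_rfl hR]
  · change z.next + g = _
    rw [hzn]
    ring
  · rw [peers_arrive hk hg, hzn]
    simp [layers]
  · intro P hP
    rw [List.mem_filter, decide_eq_true_eq] at hP
    exact ⟨hP.2, Nat.zero_le _, fun c hc => lt_of_mem_exchange hzV hl₂ hP.1 hc⟩
  · rw [mul_zero, add_zero]
    refine hinit _ _ ?_
    rcases hk.eq_or_lt with h2 | h3
    · exact Or.inr h2.symm
    · left
      have hmem : ({y.next} : Finset ℕ) ∈ z.peers := by
        rw [hz, peers_arrive hk hg]
        simp
      obtain ⟨P, hP, hsub, hcard⟩ := exists_superset_of_mem_exchange hl₂ hmem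
      rw [Finset.card_singleton] at hcard
      refine ⟨P, ?_, hsub (Finset.mem_singleton_self _), hcard, by omega⟩
      rw [layers, List.append_nil, List.mem_filter, decide_eq_true_eq]
      exact ⟨hP, by omega⟩

lemma sameProfile_singleton {z : State} {c : ℕ} (hz : z.peers = [{c}]) :
    (⟨1, [{0}]⟩ : State).SameProfile z := by
  refine ⟨Equiv.swap 0 c, List.Perm.of_eq ?_⟩
  simp [hz]

lemma subset_of_mem_support_contact {P Q P' : Finset ℕ} (h : P' ∈ (contact P Q).support) : P ⊆ P' := by
  rcases mem_support_contact.1 h with ⟨_, rfl⟩ | ⟨c, _, _, rfl⟩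
  exacts [subset_rfl, Finset.subset_insert _ _]

/-- The profile of a single peer with a single chunk can be reached if `k = 2` and one served peer
arrives in each slot. -/
lemma exists_reach_of_two (y : State) :
    ∃ l ∈ (exchange y.peers).support,
      Reach 2 (1, 0) {z | (⟨1, [{0}]⟩ : State).SameProfile z} 2 (arrive 2 y.next l 1 0) := by
  have htail : ∀ n, cohortTail 1 0 n = [] := fun n => rfl
  obtain ⟨l₁, hl₁⟩ := (exchange y.peers).support_nonempty
  refine ⟨l₁, hl₁, ?_⟩
  have hp₁ := peers_arrive le_rfl le_rfl y.next l₁ 0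
  set z₁ := arrive 2 y.next l₁ 1 0 with hz₁
  have hn₁ : z₁.next = y.next + 1 := rfl
  set r₁ := l₁.filter fun P => decide (P.card < 2) with hr₁
  rw [htail] at hp₁
  rcases r₁.eq_nil_or_concat with h | ⟨_, Q, h⟩
  · rw [h] at hp₁
    exact reach_of_mem (sameProfile_singleton hp₁) _
  have hQ : Q ∈ r₁ ++ [] := by simp [h]
  clear h
  obtain ⟨R, hR⟩ := (contact {y.next} Q).support_nonempty
  have hl₂ := mem_support_exchange_of_contact hQ hR
  rw [← hp₁] at hl₂
  refine Or.inr ⟨_, hl₂, ?_⟩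
  have hp₂ := peers_arrive le_rfl le_rfl z₁.next
    (r₁.map (insert y.next) ++ R :: [].map (insert y.next)) 0
  set z₂ := arrive 2 z₁.next (r₁.map (insert y.next) ++ R :: [].map (insert y.next)) 1 0 with hz₂
  have hn₂ : z₂.next = y.next + 1 + 1 := rfl
  set r₂ := (r₁.map (insert y.next) ++ R :: [].map (insert y.next)).filter
    fun P => decide (P.card < 2) with hr₂
  -- All peers except the newest now hold the chunk `y.next`, and for k = 2 those still present hold
  -- nothing else.
  have hmem : ∀ P ∈ r₂, P = {y.next} := by
    intro P hP
    rw [hr₂, List.mem_filter, decide_eq_true_eq] at hP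
    have h1 : y.next ∈ P := by
      have := hP.1
      simp only [List.mem_append, List.mem_map, List.map_nil, List.mem_singleton] at this
      rcases this with ⟨P₀, _, rfl⟩ | rfl
      · exact Finset.mem_insert_self _ _
      · exact subset_of_mem_support_contact hR (Finset.mem_singleton_self _)
    exact (Finset.eq_of_subset_of_card_le (Finset.singleton_subset_iff.2 h1)
      (by rw [Finset.card_singleton]; omega)).symm
  rw [htail] at hp₂
  rcases r₂.eq_nil_or_concat with h | ⟨_, Q₂, h⟩
  · rw [h] at hp₂
    exact reach_of_mem (sameProfile_singleton hp₂) _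
  have hQ₂ : Q₂ ∈ r₂ ++ [] := by simp [h]
  clear h
  obtain ⟨R₂, hR₂⟩ := (contact {z₁.next} Q₂).support_nonempty
  have hl₃ := mem_support_exchange_of_contact hQ₂ hR₂
  rw [← hp₂] at hl₃
  refine Or.inr ⟨_, hl₃, ?_⟩
  have hp₃ := peers_arrive le_rfl le_rfl z₂.next
    (r₂.map (insert z₁.next) ++ R₂ :: [].map (insert z₁.next)) 0
  rw [htail] at hp₃
  -- The two kinds of peers complete each other, so all of them leave and only the next newcomer
  -- remains.
  have hnil : (r₂.map (insert z₁.next) ++ R₂ :: [].map (insert z₁.next)).filter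
      (fun P => decide (P.card < 2)) = [] := by
    rw [List.filter_eq_nil_iff]
    intro P hP
    rw [decide_eq_true_eq, not_lt]
    simp only [List.mem_append, List.mem_map, List.map_nil, List.mem_singleton] at hP
    rcases hP with ⟨P₀, hP₀, rfl⟩ | rfl
    · rw [hmem P₀ hP₀, Finset.card_pair (by omega)]
    · rw [List.append_nil] at hQ₂
      rw [hmem Q₂ hQ₂] at hR₂
      rcases mem_support_contact.1 hR₂ with ⟨h, _⟩ | ⟨c, hc, hc', rfl⟩
      · rw [Finset.singleton_subset_iff, Finset.mem_singleton] at h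
        omega
      · rw [Finset.card_insert_of_notMem hc', Finset.card_singleton]
  rw [hnil] at hp₃
  exact sameProfile_singleton hp₃

/-- Some profile can be reached from all states within a fixed number of slots. -/
theorem exists_reach (hk : 2 ≤ k) (hg : 1 ≤ g) (u : ℕ) :
    ∃ (x : State) (s : ℕ), x.Valid k ∧ ∀ y : State, y.Valid k →
      ∃ l ∈ (exchange y.peers).support,
        Reach k (g, u) {z | x.SameProfile z} s (arrive k y.next l g u) := by
  by_cases hgu : 2 ≤ g + u
  · by_cases hg2 : 2 ≤ g
    -- The first newcomer contacts the second served one of its own slot, which is always there.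
    · refine exists_reach_of_layers (R := fun n => {n + 1, n}) (Av := fun _ _ => True) hk hg
        (fun n rest _ => ⟨{n + 1}, ?_, insert_mem_support_contact _ _⟩) (fun _ _ _ => trivial)
        (fun _ _ _ => trivial) (fun n _ c hc => ?_) (fun n _ d => ?_)
      · exact List.mem_append_right _ (mem_cohortTail.2 (Or.inl ⟨0, by omega, rfl⟩))
      · simp only [Finset.mem_insert, Finset.mem_singleton] at hc
        omega
      · simp [Finset.map_insert, add_right_comm]
    -- The only served newcomer contacts an empty one and gains nothing.
    · refine exists_reach_of_layers (R := fun n => {n}) (Av := fun _ _ => True) hk hg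
        (fun n rest _ => ⟨∅, ?_, ?_⟩) (fun _ _ _ => trivial)
        (fun _ _ _ => trivial) (fun n _ c hc => ?_) (fun n _ d => ?_)
      · exact List.mem_append_right _ (mem_cohortTail.2 (Or.inr ⟨by omega, rfl⟩))
      · exact mem_support_contact.2 (Or.inl ⟨Finset.empty_subset _, rfl⟩)
      · rw [Finset.mem_singleton] at hc
        omega
      · simp
  · obtain ⟨rfl, rfl⟩ : g = 1 ∧ u = 0 := by omega
    rcases hk.eq_or_lt with rfl | hk3
    · refine ⟨⟨1, [{0}]⟩, 2, ?_, fun y _ => exists_reach_of_two y⟩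
      intro P hP
      obtain rfl : P = {0} := by simpa using hP
      simp
    -- The lone newcomer contacts a holder of its predecessor's chunk n - 1. The predecessor itself
    -- will do: it has two chunks, and with k ≥ 3 it has not left.
    · refine exists_reach_of_layers (R := fun n => {n - 1, n})
        (Av := fun n rest => 1 ≤ n ∧ ∃ Q ∈ rest, n - 1 ∈ Q) hk hg
        (fun n rest => ?_) (fun n rest h => ⟨by omega, {n - 1, n}, h ?_, ?_⟩)
        (fun n rest h => ⟨by omega, ?_⟩) (fun n hn c hc => ?_) (fun n hn d => ?_)
      · rintro ⟨hn, Q, hQ, hnQ⟩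
        refine ⟨Q, List.mem_append_left _ hQ, mem_support_contact.2 (Or.inr ⟨n - 1, hnQ, ?_, rfl⟩)⟩
        rw [Finset.mem_singleton]
        omega
      · exact (Finset.card_le_two).trans_lt hk3
      · simp
      · rcases h with ⟨P, hP, hnP, _⟩ | h
        · exact ⟨P, hP, by simpa using hnP⟩
        · omega
      · simp only [Finset.mem_insert, Finset.mem_singleton] at hc
        omega
      · simp [Finset.map_insert, Nat.sub_add_comm hn]

end

/-! ### Conclusion and return to real time -/

/-- Stability. -/
theorem stable {k : ℕ} {law : PMF (ℕ × ℕ)} {lam : ℝ} (hk : 2 ≤ k) (hlaw : IsArrivalLaw lam law)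
    (hlam0 : 0 < lam) (hlam : lam < k) : Stable k law := by
  obtain ⟨A, hA⟩ := hlaw.bounded
  have hfin := finite_support_of_bounded hA
  obtain ⟨a, ha, ha1⟩ := hlaw.exists_served hlam0
  have hk' : (2 : ℝ) ≤ k := by exact_mod_cast hk
  have hq : 0 < expect law (fun a => if 1 ≤ a.1 then (1 : ℝ) else 0) := by
    refine lt_of_lt_of_le ?_ (apply_mul_le_expect hfin (fun a => by split_ifs <;> norm_num) a)
    rw [if_pos ha1, mul_one]
    exact ENNReal.toReal_pos ((PMF.mem_support_iff _ _).1 ha) (law.apply_ne_top a)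
  obtain ⟨T, N, hdrift⟩ := exists_drift hk hA (hlaw.expect_served hlam0.le)
    (hlaw.expect_unserved hlam0.le) hq (by
      -- For λ ≥ 1 the condition reads λ - 1 < k - 1; for λ ≤ 1 there are no unserved arrivals.
      rcases le_total 1 lam with h | h
      · rw [min_eq_left h]; linarith
      · rw [min_eq_right h]; nlinarith)
  obtain ⟨x, s, hx, hreach⟩ := exists_reach hk ha1 a.2
  exact ⟨x, hx, fun y hy =>
    meanTime_ne_top_of_drift_of_reach (a := a) (by omega) hA ha hdrift hreach hy⟩

lemma tsum_map_mul {α β : Type} (p : PMF α) (f : α → β) (g : β → ENNReal) :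
    ∑' b, p.map f b * g b = ∑' a, p a * g (f a) := by
  classical
  simp_rw [PMF.map_apply, ← ENNReal.tsum_mul_right]
  rw [ENNReal.tsum_comm]
  refine tsum_congr fun a => ?_
  rw [tsum_eq_single (f a)]
  · simp
  · intro b hb
    simp [hb]

/-- One served peer per slot, and an unserved number that takes the two integers around λ - 1 with
the right mean. Without such a law, membership of large rates in the stability region would hold
vacuously. -/
lemma exists_isArrivalLaw {lam : ℝ} (h : 1 ≤ lam) : ∃ law, IsArrivalLaw lam law := by
  set m := ⌊lam - 1⌋₊ with hm
  set θ := (lam - 1) - m with hθ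
  have hθ0 : 0 ≤ θ := sub_nonneg.2 (Nat.floor_le (by linarith))
  have hθ1 : θ ≤ 1 := by
    have := Nat.lt_floor_add_one (lam - 1)
    linarith
  have hp : ∑ b : Bool, (if b then ENNReal.ofReal θ else ENNReal.ofReal (1 - θ)) = 1 := by
    rw [Fintype.sum_bool]
    simp only [if_true, Bool.false_eq_true, if_false]
    rw [← ENNReal.ofReal_add hθ0 (by linarith)]
    simp
  refine ⟨(PMF.ofFintype _ hp).map fun b => (1, m + if b then 1 else 0), ?_, ?_, ?_⟩
  · refine ⟨m + 2, fun a ha => ?_⟩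
    rw [PMF.support_map] at ha
    obtain ⟨b, _, rfl⟩ := ha
    dsimp only
    split_ifs <;> omega
  · rw [tsum_map_mul, tsum_bool]
    simp only [PMF.ofFintype_apply, Bool.false_eq_true, if_false, if_true, add_zero]
    rw [← ENNReal.ofReal_natCast, ← ENNReal.ofReal_natCast, ← ENNReal.ofReal_mul (by linarith),
      ← ENNReal.ofReal_mul hθ0, ← ENNReal.ofReal_add (by positivity) (by positivity)]
    congr 1
    push_cast
    linarith
  · rw [tsum_map_mul, min_eq_left h]
    simp only [Nat.cast_one, mul_one, ENNReal.ofReal_one]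
    exact PMF.tsum_coe _

variable {F C : ℝ} {k : ℕ}

lemma mul_slotLength (hF : 0 < F) (hC : 0 < C) (hk : 2 ≤ k) (r : ℝ) :
    r * slotLength F C k = k * (r / ((k : ℝ) ^ 2 * C / F)) := by
  have : (0 : ℝ) < k := by exact_mod_cast (by omega : 0 < k)
  rw [slotLength]
  field_simp

lemma capacity_pos (hF : 0 < F) (hC : 0 < C) (hk : 2 ≤ k) : 0 < (k : ℝ) ^ 2 * C / F := by
  have : (0 : ℝ) < k := by exact_mod_cast (by omega : 0 < k)
  positivity

lemma mem_stabilityRegion (hF : 0 < F) (hC : 0 < C) (hk : 2 ≤ k) {r : ℝ} (hr : 0 < r)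
    (hrk : r < (k : ℝ) ^ 2 * C / F) : r ∈ stabilityRegion F C k := by
  have hk0 : (0 : ℝ) < k := by exact_mod_cast (by omega : 0 < k)
  have hc := capacity_pos hF hC hk
  refine ⟨hr, fun law hlaw => ?_⟩
  rw [mul_slotLength hF hC hk] at hlaw
  exact stable hk hlaw (by positivity) (mul_lt_of_lt_one_right hk0 ((div_lt_one hc).2 hrk))

lemma not_stable_of_lt (hF : 0 < F) (hC : 0 < C) (hk : 2 ≤ k) {r : ℝ}
    (hrk : (k : ℝ) ^ 2 * C / F < r) {law : PMF (ℕ × ℕ)}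
    (hlaw : IsArrivalLaw (r * slotLength F C k) law) : ¬ Stable k law := by
  have hk0 : (0 : ℝ) < k := by exact_mod_cast (by omega : 0 < k)
  rw [mul_slotLength hF hC hk] at hlaw
  exact not_stable hk hlaw
    (lt_mul_of_one_lt_right hk0 ((one_lt_div (capacity_pos hF hC hk)).2 hrk))

lemma Ioo_subset_stabilityRegion (hF : 0 < F) (hC : 0 < C) (hk : 2 ≤ k) :
    Set.Ioo 0 ((k : ℝ) ^ 2 * C / F) ⊆ stabilityRegion F C k :=
  fun _ hr => mem_stabilityRegion hF hC hk hr.1 hr.2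

/-- The critical rate itself is left undecided; neither the supremum nor the interior depends on it.
-/
lemma stabilityRegion_subset_Ioc (hF : 0 < F) (hC : 0 < C) (hk : 2 ≤ k) :
    stabilityRegion F C k ⊆ Set.Ioc 0 ((k : ℝ) ^ 2 * C / F) := by
  intro r hr
  refine ⟨hr.1, not_lt.1 fun h => ?_⟩
  have hk' : (2 : ℝ) ≤ k := by exact_mod_cast hk
  have h1 : 1 ≤ r * slotLength F C k := by
    rw [mul_slotLength hF hC hk]
    nlinarith [(one_lt_div (capacity_pos hF hC hk)).2 h]
  obtain ⟨law, hlaw⟩ := exists_isArrivalLaw h1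
  exact not_stable_of_lt hF hC hk h hlaw (hr.2 law hlaw)

lemma isLUB_stabilityRegion (hF : 0 < F) (hC : 0 < C) (hk : 2 ≤ k) :
    IsLUB (stabilityRegion F C k) ((k : ℝ) ^ 2 * C / F) :=
  ⟨fun _ hr => (stabilityRegion_subset_Ioc hF hC hk hr).2, fun _ hb =>
    (isLUB_Ioo (capacity_pos hF hC hk)).2 fun _ hr =>
      hb (Ioo_subset_stabilityRegion hF hC hk hr)⟩

lemma capacity_eq (hF : 0 < F) (hC : 0 < C) (hk : 2 ≤ k) :
    capacity F C k = (k : ℝ) ^ 2 * C / F :=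
  (isLUB_stabilityRegion hF hC hk).csSup_eq
    ((Set.nonempty_Ioo.2 (capacity_pos hF hC hk)).mono (Ioo_subset_stabilityRegion hF hC hk))

lemma interior_stabilityRegion (hF : 0 < F) (hC : 0 < C) (hk : 2 ≤ k) :
    interior (stabilityRegion F C k) = Set.Ioo 0 ((k : ℝ) ^ 2 * C / F) := by
  refine subset_antisymm ?_ (interior_maximal (Ioo_subset_stabilityRegion hF hC hk) isOpen_Ioo)
  exact (interior_mono (stabilityRegion_subset_Ioc hF hC hk)).trans interior_Ioc.subset

end
end FountainP2P

theorem theorem3 (F C : ℝ) (hF : 0 < F) (hC : 0 < C) :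
    (∀ k : ℕ, 2 ≤ k →
      (∀ r : ℝ, 0 < r → r < (k : ℝ) ^ 2 * C / F →
        r ∈ FountainP2P.stabilityRegion F C k) ∧
      (∀ r : ℝ, (k : ℝ) ^ 2 * C / F < r → ∀ law : PMF (ℕ × ℕ),
        FountainP2P.IsArrivalLaw (r * FountainP2P.slotLength F C k) law →
          ¬ FountainP2P.Stable k law) ∧
      IsLUB (FountainP2P.stabilityRegion F C k) ((k : ℝ) ^ 2 * C / F)) ∧
    (∀ (k k' : ℕ) (δ : ℝ), 2 ≤ k → 2 ≤ k' → (k' : ℝ) = δ * (k : ℝ) →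
      FountainP2P.capacity F C k' = δ ^ 2 * FountainP2P.capacity F C k ∧
      interior (FountainP2P.stabilityRegion F C k') =
        (fun r : ℝ => δ ^ 2 * r) '' interior (FountainP2P.stabilityRegion F C k)) := by
  refine ⟨fun k hk => ⟨fun r => FountainP2P.mem_stabilityRegion hF hC hk,
    fun r hr law => FountainP2P.not_stable_of_lt hF hC hk hr,
    FountainP2P.isLUB_stabilityRegion hF hC hk⟩, fun k k' δ hk hk' hδ => ?_⟩
  have hcap : (k' : ℝ) ^ 2 * C / F = δ ^ 2 * ((k : ℝ) ^ 2 * C / F) := by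
    rw [hδ]
    ring
  have hδ0 : δ ≠ 0 := by
    rintro rfl
    rw [zero_mul, Nat.cast_eq_zero] at hδ
    omega
  refine ⟨?_, ?_⟩
  · rw [FountainP2P.capacity_eq hF hC hk, FountainP2P.capacity_eq hF hC hk', hcap]
  · rw [FountainP2P.interior_stabilityRegion hF hC hk, FountainP2P.interior_stabilityRegion hF hC hk',
      hcap, Set.image_mul_left_Ioo (by positivity), mul_zero]
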